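/- Let $k$ be an algebraically closed field and let $H$ be a Hopf algebra over $k$ that is semisimple as a ring, cosemisimple (i.e. the sum of its simple subcoalgebras), and commutative or cocommutative. (Semisimplicity forces $H$ to be finite-dimensional.) Write $\Delta(h)=\sum h_1\otimes h_2$ for the comultiplication and $\varepsilon$ for the counit of $H$. Let $R$ be a unital associative $k$-algebra and let a $k$-linear map $H\otimes R\to R$, $h\otimes r\mapsto h\cdot r$, and a convolution-invertible $k$-linear map $\sigma:H\otimes H\to R$ be given such that for all $h,l,m\in H$ and $r,s\in R$: $$h\cdot(rs)=\sum (h_1\cdot r)(h_2\cdot s),\qquad h\cdot 1=\varepsilon(h)1,\qquad 1\cdot r=r,$$ $$h\cdot(l\cdot r)=\sum\sigma(h_1,l_1)\,(h_2l_2\cdot r)\,\sigma^{-1}(h_3,l_3),$$ $$\sum (h_1\cdot\sigma(l_1,m_1))\,\sigma(h_2,l_2m_2)=\sum\sigma(h_1,l_1)\,\sigma(h_2l_2,m),\qquad \sigma(1,h)=\sigma(h,1)=\varepsilon(h)1.$$ Let $R\#_\sigma H$ be the crossed product: the vector space $R\otimes H$ (with $a\otimes h$ written $a\#h$) with multiplication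 $(a\#h)(b\#l)=\sum a\,(h_1\cdot b)\,\sigma(h_2,l_1)\,\#\,h_3l_2$, which is an associative algebra with unit $1\#1$. For an ideal $I$ of $R$ let $I\#_\sigma H$ be the span of all $a\#h$ with $a\in I$, $h\in H$. Let $r_j$ denote the Jacobson radical of a ring, and let $r_{jH}(R)=\{x\in R : h\cdot x\in r_j(R)\text{ for all }h\in H\}$. An $R$-$H$-module is a left $R$-module $M$ with a $k$-linear map $H\otimes M\to M$ such that $1m=m$, $h(am)=\sum(h_1\cdot a)(h_2m)$ and $h(lm)=\sum\sigma(h_1,l_1)\big((h_2l_2)m\big)$ for all $h,l\in H$, $a\in R$, $m\in M$. It is irreducible if $RM\ne0$ and $M$ has no $R$-submodules stable under $H$ other than $0$ and $M$. Let $r_{Hj}(R)$ be the intersection of the annihilators in $R$ of all irreducible $R$-$H$-modules (with $r_{Hj}(R)=R$ if there are none). Then $$r_j(R)=r_{Hj}(R)=r_{jH}(R)\qquad\text{and}\qquad r_j(R\#_\sigma H)=r_{Hj}(R)\#_\sigma H .$$ -/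

import Mathlib

open scoped TensorProduct Coalgebra
open TensorProduct Coalgebra WithConv

noncomputable section

/-- A subspace `D` of a coalgebra `C` is a subcoalgebra if `Δ(D) ⊆ D ⊗ D`. -/
def IsSubcoalgebra {k C : Type*} [Field k] [AddCommGroup C] [Module k C] [Coalgebra k C]
    (D : Submodule k C) : Prop :=
  ∀ x ∈ D, comul (R := k) x ∈ LinearMap.range (TensorProduct.map D.subtype D.subtype)

/-- A simple subcoalgebra: nonzero, with no subcoalgebras other than zero and itself. -/
def IsSimpleSubcoalgebra {k C : Type*} [Field k] [AddCommGroup C] [Module k C] [Coalgebra k C]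
    (D : Submodule k C) : Prop :=
  IsSubcoalgebra D ∧ D ≠ ⊥ ∧ ∀ E : Submodule k C, IsSubcoalgebra E → E ≤ D → E = ⊥ ∨ E = D

/-- A coalgebra is cosemisimple if it is the sum of its simple subcoalgebras. -/
def IsCosemisimple (k C : Type*) [Field k] [AddCommGroup C] [Module k C] [Coalgebra k C] : Prop :=
  sSup {D : Submodule k C | IsSimpleSubcoalgebra D} = ⊤

/-- A weak action of `H` on the unital algebra `R`, written `act h r = h · r`, together with a
convolution-invertible normal 2-cocycle `σ : H ⊗ H → R` for which `R` is a twisted `H`-module.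
These are the data and conditions under which `R #_σ H` is an associative algebra with unit
`1 # 1`. Here `Units` of `WithConv (C →ₗ[k] R)` are the convolution-invertible maps, the tensor
powers of `H` carrying their usual coalgebra structure. -/
structure TwistedModuleAlgebra (k H R : Type*) [Field k] [Ring H] [HopfAlgebra k H]
    [Ring R] [Algebra k R] where
  /-- the weak action `h ⊗ r ↦ h · r` -/
  act : H →ₗ[k] R →ₗ[k] R
  /-- the cocycle -/
  σ : (WithConv (H ⊗[k] H →ₗ[k] R))ˣ
  /-- `h · (r s) = ∑ (h₁ · r) (h₂ · s)` -/
  act_mul : ∀ (h : H) (r s : R), act h (r * s) =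
    ∑ i ∈ (ℛ k h).index, act ((ℛ k h).left i) r * act ((ℛ k h).right i) s
  /-- `h · 1 = ε(h) 1` -/
  act_one : ∀ h : H, act h 1 = counit (R := k) h • (1 : R)
  /-- `1 · r = r` -/
  one_act : ∀ r : R, act 1 r = r
  /-- `h · (l · r) = ∑ σ(h₁, l₁) ((h₂ l₂) · r) σ⁻¹(h₃, l₃)` -/
  twisted : ∀ r : R,
    toConv (TensorProduct.lift (act.compl₂ (act.flip r))) =
      σ.val * toConv (act.flip r ∘ₗ LinearMap.mul' k H) * σ⁻¹.val
  /-- `∑ (h₁ · σ(l₁, m₁)) σ(h₂, l₂ m₂) = ∑ σ(h₁, l₁) σ(h₂ l₂, m)` -/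
  cocycle :
    toConv (TensorProduct.lift (act.compl₂ σ.val.ofConv)) *
        toConv (σ.val.ofConv ∘ₗ (LinearMap.mul' k H).lTensor H) =
      toConv ((TensorProduct.rid k R).toLinearMap ∘ₗ
          TensorProduct.map σ.val.ofConv (counit (R := k) (A := H)) ∘ₗ
          (TensorProduct.assoc k H H H).symm.toLinearMap) *
        toConv (σ.val.ofConv ∘ₗ (LinearMap.mul' k H).rTensor H ∘ₗ
          (TensorProduct.assoc k H H H).symm.toLinearMap)
  /-- `σ(1, h) = ε(h) 1` -/
  σ_one_left : ∀ h : H, σ.val (1 ⊗ₜ[k] h) = counit (R := k) h • (1 : R)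
  /-- `σ(h, 1) = ε(h) 1` -/
  σ_one_right : ∀ h : H, σ.val (h ⊗ₜ[k] 1) = counit (R := k) h • (1 : R)

namespace TwistedModuleAlgebra

universe u v w

variable {k : Type u} {H : Type v} {R : Type w} [Field k] [Ring H] [HopfAlgebra k H]
  [Ring R] [Algebra k R] (S : TwistedModuleAlgebra k H R)

/-- `b ⊗ c ↦ ε(c) f(b)`. -/
def extendCounit {A B : Type*} (C : Type*) [AddCommGroup A] [Module k A] [AddCommGroup B]
    [Module k B] [AddCommGroup C] [Module k C] [Coalgebra k C] (f : WithConv (B →ₗ[k] A)) :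
    WithConv (B ⊗[k] C →ₗ[k] A) :=
  toConv ((TensorProduct.rid k A).toLinearMap ∘ₗ
    TensorProduct.map f.ofConv (counit (R := k) (A := C)))

@[simp] theorem extendCounit_tmul {A B : Type*} (C : Type*) [AddCommGroup A] [Module k A]
    [AddCommGroup B] [Module k B] [AddCommGroup C] [Module k C] [Coalgebra k C]
    (f : WithConv (B →ₗ[k] A)) (b : B) (c : C) :
    extendCounit C f (b ⊗ₜ c) = counit (R := k) c • f b := by
  simp [extendCounit]

theorem extendCounit_mul_repr {A B C ι : Type*} [Ring A] [Algebra k A] [Ring B] [Bialgebra k B]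
    [Ring C] [Bialgebra k C] (f : WithConv (B →ₗ[k] A)) (X : WithConv (B ⊗[k] C →ₗ[k] A))
    (b : B) (c : C) (r : Coalgebra.Repr k b ι) : (extendCounit C f * X) (b ⊗ₜ c) =
      ∑ i ∈ r.index, f (r.left i) * X (r.right i ⊗ₜ c) := by
  rw [(r.tmul (ℛ k c)).convMul_apply, Repr.tmul_index, Finset.sum_product]
  refine Finset.sum_congr rfl fun i _ => ?_
  conv_rhs => rw [← sum_counit_smul (ℛ k c)]
  simp [TensorProduct.tmul_sum, Finset.mul_sum]

theorem extendCounit_mul_tmul {A B C : Type*} [Ring A] [Algebra k A] [Ring B] [Bialgebra k B]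
    [Ring C] [Bialgebra k C] (f : WithConv (B →ₗ[k] A)) (X : WithConv (B ⊗[k] C →ₗ[k] A))
    (b : B) (c : C) : (extendCounit C f * X) (b ⊗ₜ c) =
      ∑ i ∈ (ℛ k b).index, f ((ℛ k b).left i) * X ((ℛ k b).right i ⊗ₜ c) :=
  extendCounit_mul_repr f X b c (ℛ k b)

theorem extendCounit_mul {A B C : Type*} [Ring A] [Algebra k A] [Ring B] [Bialgebra k B]
    [Ring C] [Bialgebra k C] (f g : WithConv (B →ₗ[k] A)) :
    extendCounit C (f * g) = extendCounit C f * extendCounit C g := by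
  ext b c
  simp only [TensorProduct.AlgebraTensorModule.curry_apply, LinearMap.restrictScalars_self,
    TensorProduct.curry_apply]
  rw [extendCounit_mul_tmul, extendCounit_tmul, (ℛ k b).convMul_apply]
  simp [Finset.smul_sum]

/-- The inclusion `r ↦ r ⊗ 1`, applied to the values of a linear map. -/
def inl {C : Type*} [AddCommGroup C] [Module k C] (f : WithConv (C →ₗ[k] R)) :
    WithConv (C →ₗ[k] R ⊗[k] H) :=
  toConv ((Algebra.TensorProduct.includeLeft : R →ₐ[k] R ⊗[k] H).toLinearMap ∘ₗ f.ofConv)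

/-- The inclusion `x ↦ 1 ⊗ x`, applied to the values of a linear map. -/
def inr {C : Type*} [AddCommGroup C] [Module k C] (f : C →ₗ[k] H) :
    WithConv (C →ₗ[k] R ⊗[k] H) :=
  toConv ((Algebra.TensorProduct.includeRight : H →ₐ[k] R ⊗[k] H).toLinearMap ∘ₗ f)

@[simp] theorem inl_apply {C : Type*} [AddCommGroup C] [Module k C]
    (f : WithConv (C →ₗ[k] R)) (c : C) :
    (inl f : WithConv (C →ₗ[k] R ⊗[k] H)) c = f c ⊗ₜ 1 := rfl

@[simp] theorem inr_apply {C : Type*} [AddCommGroup C] [Module k C]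
    (f : C →ₗ[k] H) (c : C) : (inr f : WithConv (C →ₗ[k] R ⊗[k] H)) c = 1 ⊗ₜ f c := rfl

theorem inl_mul {C : Type*} [AddCommGroup C] [Module k C] [Coalgebra k C]
    (f g : WithConv (C →ₗ[k] R)) :
    (inl (f * g) : WithConv (C →ₗ[k] R ⊗[k] H)) = inl f * inl g := by
  ext1
  exact LinearMap.algHom_comp_convMul_distrib _ f g

theorem inl_extendCounit {B C : Type*} [AddCommGroup B] [Module k B] [AddCommGroup C]
    [Module k C] [Coalgebra k C] (f : WithConv (B →ₗ[k] R)) :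
    (inl (extendCounit C f) : WithConv (B ⊗[k] C →ₗ[k] R ⊗[k] H)) = extendCounit C (inl f) := by
  ext b c
  simp [TensorProduct.smul_tmul']

/-- Precomposition with a linear map. -/
def pre {A B C : Type*} [AddCommGroup A] [Module k A] [AddCommGroup B]
    [Module k B] [AddCommGroup C] [Module k C] (f : WithConv (B →ₗ[k] A)) (p : C →ₗ[k] B) :
    WithConv (C →ₗ[k] A) := toConv (f.ofConv ∘ₗ p)

@[simp] theorem pre_apply {A B C : Type*} [AddCommGroup A] [Module k A] [AddCommGroup B]
    [Module k B] [AddCommGroup C] [Module k C] (f : WithConv (B →ₗ[k] A)) (p : C →ₗ[k] B) (c : C) :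
    pre f p c = f (p c) := rfl

theorem pre_inl {B C : Type*} [AddCommGroup B] [Module k B] [AddCommGroup C] [Module k C]
    (f : WithConv (B →ₗ[k] R)) (p : C →ₗ[k] B) :
    pre (inl f : WithConv (B →ₗ[k] R ⊗[k] H)) p = inl (pre f p) := rfl

theorem pre_mul {A B C : Type*} [Ring A] [Algebra k A] [AddCommGroup B]
    [Module k B] [Coalgebra k B] [AddCommGroup C] [Module k C] [Coalgebra k C]
    (f g : WithConv (B →ₗ[k] A)) (p : C →ₗc[k] B) :
    pre (f * g) p.toLinearMap = pre f p.toLinearMap * pre g p.toLinearMap := by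
  ext1
  exact LinearMap.convMul_comp_coalgHom_distrib f g p

/-- `h ↦ h · b`. -/
def actOn (b : R) : WithConv (H →ₗ[k] R) := toConv (S.act.flip b)

@[simp] theorem actOn_apply (b : R) (h : H) : S.actOn b h = S.act h b := rfl

/-- `h ⊗ l ↦ ∑ σ(h₁, l₁) ⊗ h₂ l₂`. -/
def twist : WithConv (H ⊗[k] H →ₗ[k] R ⊗[k] H) :=
  inl S.σ.val * inr (LinearMap.mul' k H)

/-- `h ⊗ l ↦ ∑ (h₁ · b) σ(h₂, l₁) ⊗ h₃ l₂`. -/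
def mulAux (b : R) : WithConv (H ⊗[k] H →ₗ[k] R ⊗[k] H) :=
  extendCounit H (inl (S.actOn b)) * S.twist

theorem mulAux_tmul (b : R) (h l : H) : S.mulAux b (h ⊗ₜ l) =
    ∑ i ∈ (ℛ k h).index, (S.act ((ℛ k h).left i) b ⊗ₜ 1) *
      S.twist ((ℛ k h).right i ⊗ₜ l) := by
  rw [mulAux, extendCounit_mul_tmul]
  rfl

theorem twist_tmul (h l : H) : S.twist (h ⊗ₜ l) =
    ∑ i ∈ (ℛ k h).index, ∑ j ∈ (ℛ k l).index,
      S.σ.val ((ℛ k h).left i ⊗ₜ (ℛ k l).left j) ⊗ₜ ((ℛ k h).right i * (ℛ k l).right j) := by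
  rw [twist, ((ℛ k h).tmul (ℛ k l)).convMul_apply, Repr.tmul_index, Finset.sum_product]
  simp

theorem mulAux_add (b c : R) : S.mulAux (b + c) = S.mulAux b + S.mulAux c := by
  ext h l
  simp [mulAux_tmul, TensorProduct.add_tmul, add_mul, Finset.sum_add_distrib]

theorem mulAux_smul (t : k) (b : R) : S.mulAux (t • b) = t • S.mulAux b := by
  ext h l
  simp [mulAux_tmul, ← TensorProduct.smul_tmul', Finset.smul_sum]

/-- The multiplication of the crossed product,
`(a # h) (b # l) = ∑ a (h₁ · b) σ(h₂, l₁) # h₃ l₂`. -/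
def mulMap : R ⊗[k] H →ₗ[k] R ⊗[k] H →ₗ[k] R ⊗[k] H :=
  TensorProduct.lift <| LinearMap.mk₂ k
    (fun a h => TensorProduct.lift <| LinearMap.mk₂ k
      (fun b l => (a ⊗ₜ 1) * S.mulAux b (h ⊗ₜ l))
      (fun b c l => by simp [mulAux_add, mul_add])
      (fun t b l => by simp [mulAux_smul])
      (fun b l m => by simp [TensorProduct.tmul_add, mul_add])
      (fun t b l => by simp))
    (fun a b h => by ext; simp [TensorProduct.add_tmul, add_mul])
    (fun t a h => by ext; simp [← TensorProduct.smul_tmul'])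
    (fun a h l => by ext; simp [TensorProduct.add_tmul, mul_add])
    (fun t a h => by ext; simp [← TensorProduct.smul_tmul'])

theorem mulMap_tmul (a b : R) (h l : H) :
    S.mulMap (a ⊗ₜ h) (b ⊗ₜ l) = (a ⊗ₜ 1) * S.mulAux b (h ⊗ₜ l) := by
  simp [mulMap]

theorem mulMap_left (a : R) (x y : R ⊗[k] H) :
    S.mulMap ((a ⊗ₜ 1) * x) y = (a ⊗ₜ 1) * S.mulMap x y := by
  induction x with
  | zero => simp
  | add x₁ x₂ h₁ h₂ => simp [mul_add, h₁, h₂]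
  | tmul b h =>
    induction y with
    | zero => simp
    | add y₁ y₂ h₁ h₂ => simp only [map_add, mul_add, h₁, h₂]
    | tmul c l => simp [mulMap_tmul, ← mul_assoc]

theorem mulMap_mulAux (b c : R) (h l m : H) :
    S.mulMap (S.mulAux b (h ⊗ₜ l)) (c ⊗ₜ m) =
      (extendCounit H (extendCounit H (inl (S.actOn b)) * inl S.σ.val) *
        pre (S.mulAux c) ((LinearMap.mul' k H).rTensor H)).ofConv ((h ⊗ₜ l) ⊗ₜ m) := by
  rw [extendCounit_mul_tmul, mulAux, twist, ← mul_assoc, (ℛ k (h ⊗ₜ[k] l)).convMul_apply]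
  simp only [map_sum, LinearMap.sum_apply]
  refine Finset.sum_congr rfl fun i _ => ?_
  rw [← inl_extendCounit, ← inl_mul, inl_apply, mulMap_left, inr_apply, mulMap_tmul,
    ← Algebra.TensorProduct.one_def, one_mul]
  rfl

/-- `h ⊗ y ↦ h · f(y)`. -/
def actComp {C : Type*} [AddCommGroup C] [Module k C] (f : WithConv (C →ₗ[k] R)) :
    WithConv (H ⊗[k] C →ₗ[k] R) :=
  toConv (TensorProduct.lift (S.act.compl₂ f.ofConv))

@[simp] theorem actComp_tmul {C : Type*} [AddCommGroup C] [Module k C]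
    (f : WithConv (C →ₗ[k] R)) (h : H) (c : C) : S.actComp f (h ⊗ₜ c) = S.act h (f c) := by
  simp [actComp]

theorem actComp_mul {C : Type*} [Ring C] [Bialgebra k C] (f g : WithConv (C →ₗ[k] R)) :
    S.actComp (f * g) = S.actComp f * S.actComp g := by
  ext h c
  simp only [TensorProduct.AlgebraTensorModule.curry_apply, LinearMap.restrictScalars_self,
    TensorProduct.curry_apply]
  rw [actComp_tmul, (ℛ k c).convMul_apply, ((ℛ k h).tmul (ℛ k c)).convMul_apply,
    Repr.tmul_index, Finset.sum_product, Finset.sum_comm]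
  simp [act_mul]

theorem actComp_extendCounit {B C : Type*} [AddCommGroup B] [Module k B] [AddCommGroup C]
    [Module k C] [Coalgebra k C] (f : WithConv (B →ₗ[k] R)) :
    S.actComp (extendCounit C f) =
      pre (extendCounit C (S.actComp f)) (TensorProduct.assoc k H B C).symm.toLinearMap := by
  ext h b c
  simp

theorem mulMap_tmul_mulAux (a b c : R) (h l m : H) :
    S.mulMap (a ⊗ₜ h) ((b ⊗ₜ 1) * S.mulAux c (l ⊗ₜ m)) =
      (a ⊗ₜ 1) * (extendCounit (H ⊗[k] H) (inl (S.actOn b)) *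
        (inl (S.actComp (extendCounit H (S.actOn c) * S.σ.val)) *
        pre S.twist ((LinearMap.mul' k H).lTensor H))).ofConv (h ⊗ₜ (l ⊗ₜ m)) := by
  set g := extendCounit H (S.actOn c) * S.σ.val with hg
  have key : ∀ (h : H) (y : H ⊗[k] H),
      (extendCounit (H ⊗[k] H) (S.actOn b) * S.actComp g) (h ⊗ₜ y) = S.act h (b * g y) := by
    intro h y
    rw [extendCounit_mul_tmul, act_mul]
    simp
  rw [← inl_extendCounit, ← mul_assoc, ← inl_mul,
    ((ℛ k h).tmul (ℛ k (l ⊗ₜ[k] m))).convMul_apply, Repr.tmul_index, Finset.sum_product,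
    Finset.sum_comm, mulAux, twist, ← inl_extendCounit, ← mul_assoc, ← inl_mul, ← hg,
    (ℛ k (l ⊗ₜ[k] m)).convMul_apply, Finset.mul_sum, map_sum, Finset.mul_sum]
  refine Finset.sum_congr rfl fun j _ => ?_
  rw [inl_apply, inr_apply, Algebra.TensorProduct.tmul_mul_tmul,
    Algebra.TensorProduct.tmul_mul_tmul, mulMap_tmul, mulAux_tmul, one_mul, mul_one, one_mul]
  simp only [Repr.tmul_left, Repr.tmul_right, inl_apply, key]
  rfl

/-- The associator as a morphism of coalgebras. -/
def assocSymm (k H : Type*) [Field k] [Ring H] [HopfAlgebra k H] :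
    H ⊗[k] (H ⊗[k] H) →ₗc[k] (H ⊗[k] H) ⊗[k] H :=
  ((Coalgebra.TensorProduct.assoc k k H H H).symm : _ ≃ₗc[k] _).toCoalgHom

theorem pre_mulAux_aux (b c : R) :
    pre (extendCounit H (extendCounit H (inl (S.actOn b)) * inl S.σ.val) *
        pre (S.mulAux c) ((LinearMap.mul' k H).rTensor H)) (assocSymm k H).toLinearMap =
      extendCounit (H ⊗[k] H) (inl (S.actOn b)) *
        (inl (S.actComp (extendCounit H (S.actOn c) * S.σ.val)) *
        pre S.twist ((LinearMap.mul' k H).lTensor H)) := by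
  have e1 : pre (S.mulAux c) ((LinearMap.mul' k H).rTensor H) =
      pre (extendCounit H (inl (S.actOn c))) ((LinearMap.mul' k H).rTensor H) *
      (pre (inl S.σ.val) ((LinearMap.mul' k H).rTensor H) *
      pre (inr (LinearMap.mul' k H)) ((LinearMap.mul' k H).rTensor H)) := by
    rw [mulAux, twist]
    have := pre_mul (extendCounit H (inl (S.actOn c)))
      (inl S.σ.val * inr (LinearMap.mul' k H)) (CoalgHom.rTensor H (Bialgebra.mulCoalgHom k H))
    have h2 := pre_mul (A := R ⊗[k] H) (inl S.σ.val) (inr (LinearMap.mul' k H))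
      (CoalgHom.rTensor H (Bialgebra.mulCoalgHom k H))
    rw [h2] at this
    exact this
  have e2 : pre S.twist ((LinearMap.mul' k H).lTensor H) =
      pre (inl S.σ.val) ((LinearMap.mul' k H).lTensor H) *
      pre (inr (LinearMap.mul' k H)) ((LinearMap.mul' k H).lTensor H) :=
    pre_mul (A := R ⊗[k] H) (inl S.σ.val) (inr (LinearMap.mul' k H))
      (CoalgHom.lTensor H (Bialgebra.mulCoalgHom k H))
  have tw : S.actComp (S.actOn c) * S.σ.val =
      S.σ.val * pre (S.actOn c) (LinearMap.mul' k H) := by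
    have := S.twisted c
    change S.actComp (S.actOn c) = S.σ.val * pre (S.actOn c) (LinearMap.mul' k H) * _ at this
    rw [this, Units.inv_mul_cancel_right]
  have tw3 := congrArg (fun f => pre (extendCounit H f) (assocSymm k H).toLinearMap) tw
  simp only [extendCounit_mul, pre_mul] at tw3
  have co : S.actComp S.σ.val * pre S.σ.val ((LinearMap.mul' k H).lTensor H) =
      pre (extendCounit H S.σ.val) (assocSymm k H).toLinearMap *
        pre (pre S.σ.val ((LinearMap.mul' k H).rTensor H)) (assocSymm k H).toLinearMap :=
    S.cocycle
  have f1 : S.actComp (extendCounit H (S.actOn c)) =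
      pre (extendCounit H (S.actComp (S.actOn c))) (assocSymm k H).toLinearMap :=
    S.actComp_extendCounit _
  have f2 : pre (extendCounit H (pre (S.actOn c) (LinearMap.mul' k H)))
        (assocSymm k H).toLinearMap =
      pre (pre (extendCounit H (S.actOn c)) ((LinearMap.mul' k H).rTensor H))
        (assocSymm k H).toLinearMap := by
    ext x y z
    simp [assocSymm]
  have f3 : pre (extendCounit H (extendCounit H (inl (S.actOn b))))
        (assocSymm k H).toLinearMap =
      (extendCounit (H ⊗[k] H) (inl (S.actOn b)) :
        WithConv (H ⊗[k] (H ⊗[k] H) →ₗ[k] R ⊗[k] H)) := by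
    ext x y z
    simp [assocSymm, smul_smul, mul_comm]
  have f4 : pre (pre (inr (LinearMap.mul' k H)) ((LinearMap.mul' k H).rTensor H))
        (assocSymm k H).toLinearMap =
      (pre (inr (LinearMap.mul' k H)) ((LinearMap.mul' k H).lTensor H) :
        WithConv (H ⊗[k] (H ⊗[k] H) →ₗ[k] R ⊗[k] H)) := by
    ext x y z
    simp [assocSymm, mul_assoc]
  rw [e1, e2]
  simp only [extendCounit_mul, pre_mul, f3, f4, actComp_mul, f1, inl_mul, mul_assoc]
  congr 1
  simp only [← mul_assoc]
  congr 1
  simp only [← inl_extendCounit, pre_inl, ← inl_mul]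
  congr 1
  rw [← f2, ← tw3, mul_assoc, ← co, ← mul_assoc]

theorem mulMap_assoc (x y z : R ⊗[k] H) :
    S.mulMap (S.mulMap x y) z = S.mulMap x (S.mulMap y z) := by
  induction x with
  | zero => simp
  | add x₁ x₂ h₁ h₂ => simp [h₁, h₂]
  | tmul a h =>
    induction y with
    | zero => simp
    | add y₁ y₂ h₁ h₂ => simp only [map_add, LinearMap.add_apply, h₁, h₂]
    | tmul b l =>
      induction z with
      | zero => simp
      | add z₁ z₂ h₁ h₂ => simp only [map_add, h₁, h₂]
      | tmul c m =>
        rw [S.mulMap_tmul b c, S.mulMap_tmul a b, mulMap_left, mulMap_mulAux,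
          mulMap_tmul_mulAux, ← pre_mulAux_aux]
        rfl

theorem one_mulMap (x : R ⊗[k] H) : S.mulMap (1 ⊗ₜ 1) x = x := by
  induction x with
  | zero => simp
  | add x₁ x₂ h₁ h₂ => simp [h₁, h₂]
  | tmul b l =>
    let r : Coalgebra.Repr k (1 : H) Unit :=
      { index := {()}, left := fun _ => 1, right := fun _ => 1,
        eq := by simp [Algebra.TensorProduct.one_def] }
    have e : S.twist (1 ⊗ₜ l) = 1 ⊗ₜ l := by
      rw [twist, (r.tmul (ℛ k l)).convMul_apply, Repr.tmul_index, Finset.sum_product]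
      simp only [r, Finset.sum_singleton, Repr.tmul_left, Repr.tmul_right, inl_apply, inr_apply,
        σ_one_left, LinearMap.mul'_apply, one_mul, Algebra.TensorProduct.tmul_mul_tmul, mul_one,
        TensorProduct.smul_tmul, smul_mul_assoc, ← TensorProduct.tmul_sum, sum_counit_smul]
    have e2 : S.mulAux b (1 ⊗ₜ l) = b ⊗ₜ l := by
      rw [mulAux, extendCounit_mul_repr _ _ _ _ r]
      simp [r, e, one_act]
    rw [mulMap_tmul, ← Algebra.TensorProduct.one_def, one_mul, e2]

theorem mulMap_one (x : R ⊗[k] H) : S.mulMap x (1 ⊗ₜ 1) = x := by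
  induction x with
  | zero => simp
  | add x₁ x₂ h₁ h₂ => simp [h₁, h₂]
  | tmul a h =>
    let r : Coalgebra.Repr k (1 : H) Unit :=
      { index := {()}, left := fun _ => 1, right := fun _ => 1,
        eq := by simp [Algebra.TensorProduct.one_def] }
    have e : ∀ h : H, S.twist (h ⊗ₜ 1) = 1 ⊗ₜ h := by
      intro h
      rw [twist, ((ℛ k h).tmul r).convMul_apply, Repr.tmul_index, Finset.sum_product]
      simp only [r, Finset.sum_singleton, Repr.tmul_left, Repr.tmul_right, inl_apply, inr_apply,
        σ_one_right, LinearMap.mul'_apply, one_mul, Algebra.TensorProduct.tmul_mul_tmul, mul_one,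
        TensorProduct.smul_tmul, smul_mul_assoc, ← TensorProduct.tmul_sum, sum_counit_smul]
    rw [mulMap_tmul, mulAux_tmul]
    simp only [act_one, e, Algebra.TensorProduct.tmul_mul_tmul, one_mul, mul_one,
      TensorProduct.smul_tmul, smul_mul_assoc, ← TensorProduct.tmul_sum, sum_counit_smul]

/-- The crossed product `R #_σ H`: the vector space `R ⊗ H` with the multiplication
`(a # h) (b # l) = ∑ a (h₁ · b) σ(h₂, l₁) # h₃ l₂`. -/
def CrossedProduct (_S : TwistedModuleAlgebra k H R) : Type (max v w) := R ⊗[k] H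

instance : AddCommGroup S.CrossedProduct := inferInstanceAs (AddCommGroup (R ⊗[k] H))

instance : Module k S.CrossedProduct := inferInstanceAs (Module k (R ⊗[k] H))

/-- The element `a # h` of `R #_σ H`. -/
def elt (a : R) (h : H) : S.CrossedProduct := (a ⊗ₜ[k] h : R ⊗[k] H)

instance : Ring S.CrossedProduct where
  __ := (inferInstance : AddCommGroup S.CrossedProduct)
  mul x y := S.mulMap x y
  one := S.elt 1 1
  left_distrib x y z := map_add (S.mulMap x) y z
  right_distrib x y z := LinearMap.map_add₂ S.mulMap x y z
  zero_mul x := LinearMap.map_zero₂ S.mulMap x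
  mul_zero x := map_zero (S.mulMap x)
  mul_assoc := S.mulMap_assoc
  one_mul := S.one_mulMap
  mul_one := S.mulMap_one

instance : Algebra k S.CrossedProduct :=
  Algebra.ofModule (fun t x y => LinearMap.map_smul₂ S.mulMap t x y)
    (fun t x y => map_smul (S.mulMap x) t y)

theorem one_eq : (1 : S.CrossedProduct) = S.elt 1 1 := rfl

/-- The multiplication rule of the crossed product, for arbitrarily chosen expressions of the
iterated coproducts. -/
theorem elt_mul_elt (a b : R) (h l : H) : S.elt a h * S.elt b l =
    ∑ i ∈ (ℛ k h).index, ∑ j ∈ (ℛ k ((ℛ k h).right i)).index, ∑ p ∈ (ℛ k l).index,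
      S.elt (a * S.act ((ℛ k h).left i) b *
          S.σ.val ((ℛ k ((ℛ k h).right i)).left j ⊗ₜ (ℛ k l).left p))
        ((ℛ k ((ℛ k h).right i)).right j * (ℛ k l).right p) := by
  change S.mulMap (a ⊗ₜ h) (b ⊗ₜ l) = _
  rw [mulMap_tmul, mulAux_tmul]
  simp only [twist_tmul, Finset.mul_sum, Algebra.TensorProduct.tmul_mul_tmul, one_mul, mul_assoc]
  rfl

/-- For a left ideal `I` of `R`, the subspace `I #_σ H` of `R #_σ H` spanned by all `a # h` with
`a ∈ I`. -/
def idealCrossed (I : Ideal R) : Submodule k S.CrossedProduct :=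
  Submodule.span k {x | ∃ a ∈ I, ∃ h : H, x = S.elt a h}

/-- `(I : H) = {x ∈ R | h · x ∈ I for all h ∈ H}`, the largest `H`-ideal inside an ideal `I`. -/
def hCore (I : Ideal R) : Ideal R where
  carrier := {x | ∀ h : H, S.act h x ∈ I}
  zero_mem' h := by simp
  add_mem' hx hy h := by
    rw [map_add]
    exact I.add_mem (hx h) (hy h)
  smul_mem' a x hx h := by
    rw [smul_eq_mul, act_mul]
    exact I.sum_mem fun i _ => I.mul_mem_left _ (hx _)

/-- An `R`-`H`-module over the twisted `H`-module algebra `(R, σ)`: an `R`-module `M` on which `H`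
acts linearly, the action being unital, compatible with the weak action of `H` on `R`, and
associative up to the cocycle `σ`. For trivial `σ` the last condition says that `M` is an
`H`-module. -/
structure RHModule (M : Type*) [AddCommGroup M] [Module k M] [Module R M]
    [IsScalarTower k R M] where
  /-- the action `h ⊗ m ↦ h m` -/
  hact : H →ₗ[k] M →ₗ[k] M
  /-- `1 m = m` -/
  one_hact : ∀ m : M, hact 1 m = m
  /-- `h (a m) = ∑ (h₁ · a) (h₂ m)` -/
  hact_smul : ∀ (h : H) (a : R) (m : M), hact h (a • m) =
    ∑ i ∈ (ℛ k h).index, S.act ((ℛ k h).left i) a • hact ((ℛ k h).right i) m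
  /-- `h (l m) = ∑ σ(h₁, l₁) ((h₂ l₂) m)` -/
  hact_hact : ∀ (h l : H) (m : M), hact h (hact l m) =
    ∑ i ∈ (ℛ k h).index, ∑ j ∈ (ℛ k l).index,
      S.σ.val ((ℛ k h).left i ⊗ₜ (ℛ k l).left j) • hact ((ℛ k h).right i * (ℛ k l).right j) m

/-- An `R`-`H`-module `M` is irreducible if `R M ≠ 0` and it has no `R`-`H`-submodules other
than `0` and `M`. -/
def RHModule.IsIrreducible {S : TwistedModuleAlgebra k H R} {M : Type*} [AddCommGroup M]
    [Module k M] [Module R M] [IsScalarTower k R M] (V : S.RHModule M) : Prop :=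
  (∃ (a : R) (m : M), a • m ≠ 0) ∧
    ∀ N : Submodule R M, (∀ (h : H), ∀ m ∈ N, V.hact h m ∈ N) → N = ⊥ ∨ N = ⊤

/-- The `H`-Jacobson radical `r_{Hj}(R)`: the intersection of the annihilators in `R` of all
irreducible `R`-`H`-modules (and `R` itself if there are none). The universe is large enough to
hold a copy of every such module, since each is a quotient of the vector space `R ⊗ H`. -/
def hJacobson : Ideal R :=
  sInf {I | ∃ (M : Type (max v w)) (_ : AddCommGroup M) (_ : Module k M) (_ : Module R M)
    (_ : IsScalarTower k R M) (V : S.RHModule M),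
      V.IsIrreducible ∧ I = Module.annihilator R M}

/-- `r_{jH}(R) = (r_j(R) : H)`. -/
def jacobsonH : Ideal R := S.hCore (Ring.jacobson R)

end TwistedModuleAlgebra

end

/-!
Let `A = R #_σ H` and write `J` for the Jacobson radical. Everything follows from the two inclusions
`J(R) ⊆ J(A)` and `J(A) ⊆ J(R) #_σ H` (`TwistedModuleAlgebra.radicals_eq`). Indeed `R`-`H`-modules
are `A`-modules, so `r_{Hj}(R) = J(A) ∩ R` (`TwistedModuleAlgebra.mem_hJacobson_iff`), and
`∑ h₁ · r # h₂ = (1 # h)(r # 1)` shows that `J(R)` is stable under `H`.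

A normalized integral of the semisimple Hopf algebra `H` yields a Casimir element, so `H` is
finite-dimensional. As `k` is algebraically closed, `H` is then described by a finite group `G` whose
order is invertible in `k`.

* If `H` is cocommutative, each simple subcoalgebra is spanned by a group-like element, since the
  dual algebra is commutative and has a character; hence `H = k[G]` and `A` is a crossed product of
  `R` by the group `G` of group-like elements. Nakayama's lemma for simple `A`-modules, which are
  finitely generated over `R`, gives `J(R) ⊆ J(A)`. Conversely, for a simple `R`-module `V` the
  coinduced module `Hom_R(A, V)` is a sum of conjugates of `V` over `R`, hence semisimple over `A` by
  Maschke's averaging argument, so `J(A)` kills it; this says that the coordinates of elements of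
  `J(A)` kill `V` (`GroupCrossedProduct.coeff_mem_jacobson`).

* If `H` is commutative, the characters of `H` separate its elements and form a group `G`, which acts
  on `A` by `a # h ↦ ∑ a # h₁ χ(h₂)` with fixed ring `R`. The averaging argument, applied to the sum of
  the conjugates of a simple `A`-module `W`, shows that `W` is semisimple over the fixed ring, so
  `J(R) ⊆ J(A)` (`map_mem_jacobson_of_fixedRing`). Conversely `J(A) ∩ R ⊆ J(R)`, because an element
  of `R` that is invertible in `A` is invertible in `R`. Finally `h ↦ 1 # h` has a left convolution
  inverse, which makes `A` a Galois extension of `R`: there are `xᵢ, yᵢ ∈ A` with `∑ χ(xᵢ) yᵢ = δ_{χ,1}`. So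
  `z = ∑ tr(z xᵢ) yᵢ` for all `z ∈ A`, and for `z ∈ J(A)` the traces lie in `J(A) ∩ R = J(R)`.
-/

/-! ### Finite groups acting on modules: averaging -/

/-- The module `W` with scalars acting through the ring endomorphism `f`. -/
def TwistedModule {A : Type*} [Ring A] (_f : A →+* A) (W : Type*) := W

namespace TwistedModule

variable {A W : Type*} [Ring A] [AddCommGroup W] [Module A W] (f : A →+* A)

instance : AddCommGroup (TwistedModule f W) := inferInstanceAs (AddCommGroup W)

instance : Module A (TwistedModule f W) := Module.compHom W f

variable {f} in
/-- The element of `W` underlying an element of the twisted module. -/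
def val (w : TwistedModule f W) : W := w

variable {f} in
theorem val_smul (a : A) (w : TwistedModule f W) : (a • w).val = f a • w.val := rfl

theorem isSemisimpleModule (hf : Function.Surjective f) [IsSemisimpleModule A W] :
    IsSemisimpleModule A (TwistedModule f W) := by
  have : RingHomSurjective f := ⟨hf⟩
  let l : TwistedModule f W →ₛₗ[f] W :=
    { toFun := fun w => w
      map_add' := fun _ _ => rfl
      map_smul' := fun _ _ => rfl }
  exact (l.isSemisimpleModule_iff_of_bijective Function.bijective_id).2 inferInstance

end TwistedModule

/-- Maschke's averaging for a projective semilinear action `u` of a finite group: a projection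
onto a submodule stable under the operators `u g` and their inverses `v g` can be chosen to commute
with all `u g`. -/
theorem exists_equivariant_projection {R M G : Type*} [Ring R] [AddCommGroup M] [Module R M]
    [Group G] [Fintype G] (d : R) (hd : d * (Fintype.card G : R) = 1)
    (φ : G → R →+* R) (u v : G → M →+ M) (huv : ∀ g m, u g (v g m) = m)
    (hvu : ∀ g m, v g (u g m) = m) (hu : ∀ g (r : R) m, u g (r • m) = φ g r • u g m)
    (c : G → G → R) (huu : ∀ g h m, u g (u h m) = c g h • u (g * h) m)
    (N : Submodule R M) (hN : IsComplemented N)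
    (hNu : ∀ g, ∀ n ∈ N, u g n ∈ N) (hNv : ∀ g, ∀ n ∈ N, v g n ∈ N) :
    ∃ P : M →ₗ[R] M, (∀ m, P m ∈ N) ∧ (∀ n ∈ N, P n = n) ∧ ∀ g m, P (u g m) = u g (P m) := by
  classical
  obtain ⟨N', hN'⟩ := hN
  set π : M →ₗ[R] M := N.subtype ∘ₗ N.projectionOnto N' hN' with hπ
  have π_mem : ∀ m, π m ∈ N := fun m => (N.projectionOnto N' hN' m).2
  have π_id : ∀ n ∈ N, π n = n := by
    intro n hn
    have := Submodule.projectionOnto_apply_left hN' ⟨n, hn⟩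
    simp only [hπ, LinearMap.comp_apply, Submodule.subtype_apply] at this ⊢
    rw [this]
  have card_smul : ∀ m : M, d • (Fintype.card G • m) = m := by
    intro m
    rw [← Nat.cast_smul_eq_nsmul R, smul_smul, hd, one_smul]
  have hd' : (Fintype.card G : R) * d = 1 := by rw [Nat.cast_comm, hd]
  have d_comm : ∀ r : R, d * r = r * d := by
    intro r
    calc d * r = d * r * ((Fintype.card G : R) * d) := by rw [hd', mul_one]
      _ = d * (r * (Fintype.card G : R)) * d := by simp only [mul_assoc]
      _ = d * ((Fintype.card G : R) * r) * d := by rw [Nat.cast_comm]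
      _ = r * d := by rw [← mul_assoc d, hd, one_mul]
  have card_inj : ∀ m m' : M, Fintype.card G • m = Fintype.card G • m' → m = m' := by
    intro m m' h
    rw [← card_smul m, h, card_smul]
  have v_smul : ∀ g (r : R) m, v g (φ g r • m) = r • v g m := by
    intro g r m
    rw [← hvu g (r • v g m), hu, huv]
  set Q : M → M := fun m => ∑ g, v g (π (u g m)) with hQ
  have Q_add : ∀ m m', Q (m + m') = Q m + Q m' := by
    intro m m'
    simp [hQ, Finset.sum_add_distrib]
  have Q_smul : ∀ (r : R) m, Q (r • m) = r • Q m := by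
    intro r m
    simp only [hQ, Finset.smul_sum]
    refine Finset.sum_congr rfl fun g _ => ?_
    rw [hu, map_smul, v_smul]
  have Q_u : ∀ h m, Q (u h m) = u h (Q m) := by
    intro h m
    simp only [hQ, map_sum]
    rw [← Equiv.sum_comp (Equiv.mulRight h) fun g => u h (v g (π (u g m)))]
    refine Finset.sum_congr rfl fun g _ => ?_
    rw [Equiv.coe_mulRight, huu, map_smul]
    -- `u g ∘ u h = c • u (g h)` also reads `v g ∘ c = u h ∘ v (g h)`
    have : ∀ x, v g (c g h • x) = u h (v (g * h) x) := by
      intro x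
      rw [← hvu g (u h (v (g * h) x)), huu, huv]
    rw [this]
  refine ⟨{ toFun := fun m => d • Q m, map_add' := ?_, map_smul' := ?_ }, ?_, ?_, ?_⟩
  · intro m m'
    rw [Q_add, smul_add]
  · intro r m
    rw [Q_smul, smul_smul, d_comm, RingHom.id_apply, smul_smul]
  · intro m
    exact N.smul_mem _ (N.sum_mem fun g _ => hNv g _ (π_mem _))
  · intro n hn
    have : Q n = Fintype.card G • n := by
      rw [hQ, ← Finset.card_univ, ← Finset.sum_const]
      exact Finset.sum_congr rfl fun g _ => by rw [π_id _ (hNu g n hn), hvu]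
    change d • Q n = n
    rw [this, card_smul]
  · intro g m
    change d • Q (u g m) = u g (d • Q m)
    apply card_inj
    rw [← map_nsmul, Q_u, ← Nat.cast_smul_eq_nsmul R, ← Nat.cast_smul_eq_nsmul R, smul_smul,
      smul_smul, hd', one_smul, one_smul]

/-! ### The Jacobson radical of a crossed product by a finite group -/

/-- `A` is a crossed product of the ring `R` by the group `G`: it is free as a left `R`-module on
elements `γ g`, which normalize `R` and multiply like the elements of `G` up to units of `R`. -/
structure GroupCrossedProduct (R A G : Type*) [Ring R] [Ring A] [Group G] [Fintype G]
    [DecidableEq G] where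
  /-- the inclusion of the base ring -/
  ι : R →+* A
  /-- the basis elements -/
  γ : G → A
  /-- conjugation by `γ g` on the base ring -/
  φ : G → R →+* R
  /-- the cocycle -/
  c : G → G → Rˣ
  /-- the coordinates with respect to the basis -/
  coeff : A →+ G → R
  γ_one : γ 1 = 1
  γ_mul : ∀ g h, γ g * γ h = ι (c g h) * γ (g * h)
  γ_ι : ∀ g r, γ g * ι r = ι (φ g r) * γ g
  coeff_ι_mul : ∀ r x g, coeff (ι r * x) g = r * coeff x g
  coeff_γ : ∀ g, coeff (γ g) = Pi.single g 1
  sum_coeff : ∀ x, ∑ g, ι (coeff x g) * γ g = x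

namespace GroupCrossedProduct

variable {R A G : Type*} [Ring R] [Ring A] [Group G] [Fintype G] [DecidableEq G]
  (X : GroupCrossedProduct R A G)

theorem coeff_ι (r : R) (g : G) : X.coeff (X.ι r) g = r * (Pi.single 1 1 : G → R) g := by
  rw [← mul_one (X.ι r), ← X.γ_one, X.coeff_ι_mul, X.coeff_γ]

theorem ι_injective : Function.Injective X.ι := by
  intro r s h
  have := congrArg (fun x => X.coeff x 1) h
  simpa [X.coeff_ι] using this

theorem isUnit_γ (g : G) : IsUnit (X.γ g) := by
  have e : ∀ g : G, IsUnit (X.γ g * X.γ g⁻¹) := by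
    intro g
    rw [X.γ_mul, mul_inv_cancel, X.γ_one, mul_one]
    exact (X.c g g⁻¹).isUnit.map X.ι
  obtain ⟨a, ha⟩ := e g
  obtain ⟨b, hb⟩ := e g⁻¹
  rw [inv_inv] at hb
  refine isUnit_iff_exists_and_exists.2
    ⟨⟨X.γ g⁻¹ * ↑a⁻¹, ?_⟩, ⟨↑b⁻¹ * X.γ g⁻¹, ?_⟩⟩
  · rw [← mul_assoc, ← ha, Units.mul_inv]
  · rw [mul_assoc, ← hb, Units.inv_mul]

theorem φ_surjective (g : G) : Function.Surjective (X.φ g) := by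
  intro s
  set c := X.c g g⁻¹
  refine ⟨X.φ g⁻¹ (↑c⁻¹ * s * ↑c), X.ι_injective ?_⟩
  have key : ∀ r, X.ι (X.φ g (X.φ g⁻¹ r)) * X.ι c = X.ι c * X.ι r := by
    intro r
    have h1 : X.γ g * X.γ g⁻¹ = X.ι c := by
      rw [X.γ_mul, mul_inv_cancel, X.γ_one, mul_one]
    rw [← h1, ← mul_assoc, ← X.γ_ι, mul_assoc, ← X.γ_ι, mul_assoc]
  have hc : IsUnit (X.ι (c : R)) := c.isUnit.map X.ι
  refine hc.mul_left_injective ?_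
  simp only [key, ← map_mul]
  simp [← mul_assoc]

theorem φ_mem_jacobson (g : G) {r : R} (hr : r ∈ Ring.jacobson R) :
    X.φ g r ∈ Ring.jacobson R := by
  have : RingHomSurjective (X.φ g) := ⟨X.φ_surjective g⟩
  exact Ring.le_comap_jacobson (X.φ g) hr

/-- By Nakayama's lemma: a simple module over the crossed product is finitely generated over the
base ring, and the radical of the base ring moves it to a proper submodule of the crossed
product. -/
theorem jacobson_smul_simple {W : Type*} [AddCommGroup W] [Module A W] [IsSimpleModule A W]
    [Module R W] (hW : ∀ (r : R) (w : W), r • w = X.ι r • w)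
    {r : R} (hr : r ∈ Ring.jacobson R) (w : W) : r • w = 0 := by
  have := IsSimpleModule.nontrivial A W
  obtain ⟨w₀, hw₀⟩ := exists_ne (0 : W)
  have : Module.Finite R W := by
    classical
    refine ⟨⟨Finset.univ.image fun g => X.γ g • w₀, eq_top_iff.2 fun w _ => ?_⟩⟩
    obtain ⟨x, rfl⟩ := IsSimpleModule.toSpanSingleton_surjective A hw₀ w
    rw [LinearMap.toSpanSingleton_apply, ← X.sum_coeff x, Finset.sum_smul]
    refine Submodule.sum_mem _ fun g _ => ?_
    rw [mul_smul, ← hW]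
    exact Submodule.smul_mem _ _ (Submodule.subset_span (by simp))
  have hlt := Submodule.jacobson_smul_lt_top (R := R) (⊤ : Submodule R W)
  have hr' : r • w ∈ Ring.jacobson R • (⊤ : Submodule R W) :=
    Submodule.smul_mem_smul hr Submodule.mem_top
  have hγ : ∀ g, ∀ n ∈ Ring.jacobson R • (⊤ : Submodule R W),
      X.γ g • n ∈ Ring.jacobson R • (⊤ : Submodule R W) := by
    intro g n hn
    refine Submodule.smul_induction_on hn (fun s hs m _ => ?_) (fun m m' hm hm' => ?_)
    · rw [hW, smul_smul, X.γ_ι, mul_smul, ← hW]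
      exact Submodule.smul_mem_smul (X.φ_mem_jacobson g hs) Submodule.mem_top
    · rw [smul_add]
      exact Submodule.add_mem _ hm hm'
  generalize Ring.jacobson R • (⊤ : Submodule R W) = N at hlt hr' hγ
  let N' : Submodule A W :=
    { N.toAddSubmonoid with
      smul_mem' := fun x n hn => by
        change x • n ∈ N
        rw [← X.sum_coeff x, Finset.sum_smul]
        refine N.sum_mem fun g _ => ?_
        rw [mul_smul, ← hW]
        exact N.smul_mem _ (hγ g n hn) }
  rcases eq_bot_or_eq_top N' with h | h
  · have : r • w ∈ N' := hr'
    rwa [h, Submodule.mem_bot] at this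
  · refine absurd (eq_top_iff.2 fun w _ => ?_) hlt.ne
    have : w ∈ N' := h ▸ Submodule.mem_top
    exact this

theorem ι_mem_jacobson {r : R} (hr : r ∈ Ring.jacobson R) : X.ι r ∈ Ring.jacobson A := by
  rw [Ring.jacobson_eq_sInf_isMaximal, Submodule.mem_sInf]
  intro m hm
  have : IsSimpleModule A (A ⧸ m) := isSimpleModule_iff_isCoatom.2 (Ideal.isMaximal_def.1 hm)
  let : Module R (A ⧸ m) := Module.compHom _ X.ι
  have := X.jacobson_smul_simple (fun _ _ => rfl) hr (Submodule.Quotient.mk (p := m) (1 : A))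
  change X.ι r • Submodule.Quotient.mk (p := m) (1 : A) = 0 at this
  rwa [← Submodule.Quotient.mk_smul, Submodule.Quotient.mk_eq_zero, smul_eq_mul, mul_one] at this

/-- Maschke's theorem for crossed products. -/
theorem isSemisimpleModule {M : Type*} [AddCommGroup M] [Module A M] [Module R M]
    (hM : ∀ (r : R) (m : M), r • m = X.ι r • m) [IsSemisimpleModule R M]
    (hG : IsUnit (Fintype.card G : R)) : IsSemisimpleModule A M := by
  choose γi hγi using fun g => (X.isUnit_γ g).exists_left_inv
  choose γj hγj using fun g => (X.isUnit_γ g).exists_right_inv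
  have hij : ∀ g, γj g = γi g := fun g => (left_inv_eq_right_inv (hγi g) (hγj g)).symm
  obtain ⟨d, hd⟩ := hG.exists_left_inv
  rw [isSemisimpleModule_iff]
  refine ⟨fun N => ?_⟩
  let N₀ : Submodule R M :=
    { N.toAddSubmonoid with
      smul_mem' := fun r n hn => by
        rw [hM]
        exact N.smul_mem _ hn }
  obtain ⟨P, hP, hPN, hPu⟩ := exists_equivariant_projection d hd X.φ
    (fun g => DistribSMul.toAddMonoidHom M (X.γ g)) (fun g => DistribSMul.toAddMonoidHom M (γi g))
    (fun g m => by simp [smul_smul, ← hij, hγj]) (fun g m => by simp [smul_smul, hγi])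
    (fun g r m => by simp [hM, smul_smul, X.γ_ι]) (fun g h => (X.c g h : R))
    (fun g h m => by simp [hM, smul_smul, X.γ_mul]) N₀ (exists_isCompl N₀)
    (fun g n hn => N.smul_mem _ hn) (fun g n hn => N.smul_mem _ hn)
  let P' : M →ₗ[A] N :=
    { toFun := fun m => ⟨P m, hP m⟩
      map_add' := fun m m' => Subtype.ext (P.map_add m m')
      map_smul' := fun x m => Subtype.ext <| by
        change P (x • m) = x • P m
        conv_lhs => rw [← X.sum_coeff x]
        conv_rhs => rw [← X.sum_coeff x]
        rw [Finset.sum_smul, Finset.sum_smul, map_sum]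
        refine Finset.sum_congr rfl fun g _ => ?_
        rw [mul_smul, mul_smul, ← hM, ← hM, map_smul]
        congr 1
        exact hPu g m }
  exact ⟨_, LinearMap.isCompl_of_proj (f := P') fun n => Subtype.ext (hPN n n.2)⟩

/-- The coinduced module `Hom_R(A, V)`, on which `A` acts by right translation of the argument. -/
def Coinduced (V : Type*) [AddCommGroup V] [Module R V] : AddSubgroup (A →+ V) where
  carrier := {f | ∀ r x, f (X.ι r * x) = r • f x}
  add_mem' hf hg r x := by simp [hf r x, hg r x]
  zero_mem' r x := by simp
  neg_mem' hf r x := by simp [hf r x]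

namespace Coinduced

variable (V : Type*) [AddCommGroup V] [Module R V]

instance : Module A (X.Coinduced V) where
  smul x f := ⟨f.1.comp (AddMonoidHom.mulRight x), fun r y => by
    change f.1 (X.ι r * y * x) = r • f.1 (y * x)
    rw [mul_assoc, f.2]⟩
  one_smul f := Subtype.ext (AddMonoidHom.ext fun y => congrArg f.1 (mul_one y))
  mul_smul x x' f := Subtype.ext (AddMonoidHom.ext fun y => congrArg f.1 (mul_assoc y x x').symm)
  smul_zero x := rfl
  zero_smul f := Subtype.ext (AddMonoidHom.ext fun y =>
    (congrArg f.1 (mul_zero y)).trans (map_zero f.1))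
  smul_add x f g := rfl
  add_smul x x' f := Subtype.ext (AddMonoidHom.ext fun y =>
    (congrArg f.1 (mul_add y x x')).trans (map_add f.1 _ _))

theorem smul_apply (x y : A) (f : X.Coinduced V) : (x • f).1 y = f.1 (y * x) := rfl

theorem apply_eq_sum (f : X.Coinduced V) (x : A) : f.1 x = ∑ g, X.coeff x g • f.1 (X.γ g) := by
  conv_lhs => rw [← X.sum_coeff x]
  rw [map_sum]
  exact Finset.sum_congr rfl fun g _ => f.2 _ _

/-- The element of the coinduced module with prescribed values on the basis `γ`. -/
def ofValues (v : G → V) : X.Coinduced V :=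
  ⟨{ toFun := fun x => ∑ g, X.coeff x g • v g
     map_zero' := by simp
     map_add' := fun x y => by simp [add_smul, Finset.sum_add_distrib] }, fun r x => by
    simp [X.coeff_ι_mul, Finset.smul_sum, mul_smul]⟩

theorem ofValues_apply (v : G → V) (x : A) :
    (ofValues X V v).1 x = ∑ g, X.coeff x g • v g := rfl

/-- Restricted to the base ring, the module coinduced from `V` is the direct sum of the conjugates
of `V`. -/
theorem isSemisimpleModule [IsSemisimpleModule R V] (hG : IsUnit (Fintype.card G : R)) :
    IsSemisimpleModule A (X.Coinduced V) := by
  let : Module R (X.Coinduced V) := Module.compHom _ X.ι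
  have smul_def : ∀ (r : R) (f : X.Coinduced V), r • f = X.ι r • f := fun _ _ => rfl
  have : ∀ g, IsSemisimpleModule R (TwistedModule (X.φ g) V) :=
    fun g => TwistedModule.isSemisimpleModule _ (X.φ_surjective g)
  let e : X.Coinduced V →ₗ[R] ∀ g, TwistedModule (X.φ g) V :=
    { toFun := fun f g => f.1 (X.γ g)
      map_add' := fun f f' => rfl
      map_smul' := fun r f => funext fun g => by
        rw [smul_def, smul_apply, X.γ_ι, f.2]
        rfl }
  have he : Function.Injective e := by
    intro f f' h
    refine Subtype.ext (AddMonoidHom.ext fun x => ?_)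
    rw [apply_eq_sum, apply_eq_sum]
    exact Finset.sum_congr rfl fun g _ => congrArg _ (congrFun h g)
  have : IsSemisimpleModule R (X.Coinduced V) := IsSemisimpleModule.of_injective e he
  exact X.isSemisimpleModule smul_def hG

end Coinduced

theorem coeff_mem_jacobson (hG : IsUnit (Fintype.card G : R)) {x : A}
    (hx : x ∈ Ring.jacobson A) (g : G) : X.coeff x g ∈ Ring.jacobson R := by
  rw [Ring.jacobson_eq_sInf_isMaximal, Submodule.mem_sInf]
  intro m hm
  have : IsSimpleModule R (R ⧸ m) := isSimpleModule_iff_isCoatom.2 (Ideal.isMaximal_def.1 hm)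
  have := Coinduced.isSemisimpleModule X (R ⧸ m) hG
  have h := Module.mem_annihilator.1
    (IsSemisimpleModule.jacobson_le_annihilator A (X.Coinduced (R ⧸ m)) hx)
    (Coinduced.ofValues X (R ⧸ m) (Pi.single g (Submodule.Quotient.mk 1)))
  have h1 := congrArg (fun f => f.1 1) h
  simp only [Coinduced.smul_apply, Coinduced.ofValues_apply, one_mul] at h1
  rw [Finset.sum_eq_single g (fun b _ hb => by simp [Pi.single_eq_of_ne hb])
    (fun hg => (hg (Finset.mem_univ g)).elim), Pi.single_eq_same,
    ← Submodule.Quotient.mk_smul] at h1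
  change Submodule.Quotient.mk _ = (0 : R ⧸ m) at h1
  rwa [Submodule.Quotient.mk_eq_zero, smul_eq_mul, mul_one] at h1

end GroupCrossedProduct

/-! ### The Jacobson radical of a fixed ring -/

/-- A simple module over a ring with a finite group of automorphisms stays semisimple over the
fixed ring, if the order of the group is invertible. For a submodule `N` over the fixed ring, the
averaging is applied to the direct sum of all conjugates of `W` and its submodule generated by the
diagonal copy of `N`; an equivariant projection preserves the diagonal. -/
theorem isSemisimpleModule_fixedRing {A G R W : Type*} [Ring A] [Ring R] [Group G] [Fintype G]
    (φ : G → A →+* A) (φ_one : ∀ a, φ 1 a = a) (φ_mul : ∀ g h a, φ (g * h) a = φ g (φ h a))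
    (ι : R →+* A) (φ_ι : ∀ g r, φ g (ι r) = ι r)
    (fixed : ∀ a, (∀ g, φ g a = a) → a ∈ Set.range ι) (hG : IsUnit (Fintype.card G : R))
    [AddCommGroup W] [Module A W] [IsSemisimpleModule A W] [Module R W]
    (hW : ∀ (r : R) (w : W), r • w = ι r • w) : IsSemisimpleModule R W := by
  obtain ⟨d, hd⟩ := hG.exists_left_inv
  have hd' : ι d * (Fintype.card G : A) = 1 := by rw [← map_natCast ι, ← map_mul, hd, map_one]
  have φ_surj : ∀ g, Function.Surjective (φ g) := fun g a =>
    ⟨φ g⁻¹ a, by rw [← φ_mul, mul_inv_cancel, φ_one]⟩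
  have : ∀ g, IsSemisimpleModule A (TwistedModule (φ g) W) :=
    fun g => TwistedModule.isSemisimpleModule _ (φ_surj g)
  let M := ∀ g, TwistedModule (φ g) W
  let diag : W → M := fun w _ => w
  let u : G → M →+ M := fun h =>
    { toFun := fun f g => f (g * h)
      map_zero' := rfl
      map_add' := fun f f' => rfl }
  rw [isSemisimpleModule_iff]
  refine ⟨fun N => ?_⟩
  let U : Submodule A M := Submodule.span A (diag '' N)
  have u_smul : ∀ h (a : A) (f : M), u h (a • f) = φ h a • u h f := by
    intro h a f
    funext g
    change φ (g * h) a • (f (g * h)).val = φ g (φ h a) • (f (g * h)).val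
    rw [φ_mul]
  have u_diag : ∀ h w, u h (diag w) = diag w := fun h w => rfl
  have u_u : ∀ g h (f : M), u g (u h f) = u (g * h) f := by
    intro g h f
    funext x
    change (f (x * g * h) : W) = f (x * (g * h))
    rw [mul_assoc]
  have u_one : ∀ f : M, u 1 f = f := by
    intro f
    funext x
    change (f (x * 1) : W) = f x
    rw [mul_one]
  have hU : ∀ h, ∀ f ∈ U, u h f ∈ U := by
    intro h f hf
    induction hf using Submodule.span_induction with
    | mem f hf =>
      obtain ⟨n, hn, rfl⟩ := hf
      exact Submodule.subset_span ⟨n, hn, rfl⟩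
    | zero => simp
    | add f f' _ _ h1 h2 => rw [map_add]; exact U.add_mem h1 h2
    | smul a f _ h1 => rw [u_smul]; exact U.smul_mem _ h1
  obtain ⟨P, hP, hPU, hPu⟩ := exists_equivariant_projection (ι d) hd' φ u (fun g => u g⁻¹)
    (fun g f => by rw [u_u, mul_inv_cancel, u_one]) (fun g f => by rw [u_u, inv_mul_cancel, u_one])
    u_smul (fun _ _ => 1) (fun g h f => by rw [u_u, one_smul]) U (exists_isCompl U) hU
    (fun g => hU g⁻¹)
  -- an invariant vector of the direct sum is diagonal
  have P_diag : ∀ w, P (diag w) = diag (P (diag w) 1) := by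
    intro w
    funext g
    have := congrFun (hPu g (diag w)) 1
    rw [u_diag] at this
    change (P (diag w) 1 : W) = P (diag w) (1 * g) at this
    rw [one_mul] at this
    exact this.symm
  have trace_mem : ∀ f ∈ U, ∀ a : A, (∑ g, φ g a • (f g).val) ∈ N := by
    intro f hf
    induction hf using Submodule.span_induction with
    | mem f hf =>
      obtain ⟨n, hn, rfl⟩ := hf
      intro a
      obtain ⟨r, hr⟩ := fixed (∑ g, φ g a) (fun h => by
        rw [map_sum, ← Equiv.sum_comp (Equiv.mulLeft h) fun g => φ g a]
        exact Finset.sum_congr rfl fun g _ => (φ_mul h g a).symm)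
      change ∑ g, φ g a • n ∈ N
      rw [← Finset.sum_smul, ← hr, ← hW]
      exact N.smul_mem _ hn
    | zero =>
      intro a
      change ∑ g, φ g a • (0 : W) ∈ N
      simp
    | add f f' _ _ h1 h2 =>
      intro a
      change ∑ g, φ g a • ((f g).val + (f' g).val) ∈ N
      simp only [smul_add, Finset.sum_add_distrib]
      exact N.add_mem (h1 a) (h2 a)
    | smul b f _ h1 =>
      intro a
      have := h1 (a * b)
      simp only [map_mul, mul_smul] at this
      exact this
  have diag_mem : ∀ w, diag w ∈ U → w ∈ N := by
    intro w hw
    have := trace_mem _ hw 1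
    simp only [map_one, one_smul] at this
    change ∑ _g : G, w ∈ N at this
    rw [Finset.sum_const, Finset.card_univ] at this
    have h2 := N.smul_mem d this
    rwa [← Nat.cast_smul_eq_nsmul R, smul_smul, hd, one_smul] at h2
  let p : W →ₗ[R] N :=
    { toFun := fun w => ⟨P (diag w) 1, diag_mem _ (P_diag w ▸ hP _)⟩
      map_add' := fun w w' => Subtype.ext (congrFun (P.map_add (diag w) (diag w')) 1)
      map_smul' := fun r w => Subtype.ext <| by
        have : diag (r • w) = ι r • diag w := by
          funext g
          change r • w = φ g (ι r) • w
          rw [φ_ι, hW]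
        change (P (diag (r • w)) 1).val = r • (P (diag w) 1).val
        rw [this, map_smul, Pi.smul_apply, TwistedModule.val_smul, φ_ι, hW] }
  exact ⟨_, LinearMap.isCompl_of_proj (f := p) fun n => Subtype.ext
    (congrFun (hPU (diag n) (Submodule.subset_span ⟨n, n.2, rfl⟩)) 1)⟩

theorem map_mem_jacobson_of_fixedRing {A G R : Type*} [Ring A] [Ring R] [Group G] [Fintype G]
    (φ : G → A →+* A) (φ_one : ∀ a, φ 1 a = a) (φ_mul : ∀ g h a, φ (g * h) a = φ g (φ h a))
    (ι : R →+* A) (φ_ι : ∀ g r, φ g (ι r) = ι r)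
    (fixed : ∀ a, (∀ g, φ g a = a) → a ∈ Set.range ι) (hG : IsUnit (Fintype.card G : R))
    {r : R} (hr : r ∈ Ring.jacobson R) : ι r ∈ Ring.jacobson A := by
  rw [Ring.jacobson_eq_sInf_isMaximal, Submodule.mem_sInf]
  intro m hm
  have : IsSimpleModule A (A ⧸ m) := isSimpleModule_iff_isCoatom.2 (Ideal.isMaximal_def.1 hm)
  let : Module R (A ⧸ m) := Module.compHom _ ι
  have : IsSemisimpleModule R (A ⧸ m) :=
    isSemisimpleModule_fixedRing φ φ_one φ_mul ι φ_ι fixed hG (fun _ _ => rfl)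
  have := Module.mem_annihilator.1
    (IsSemisimpleModule.jacobson_le_annihilator R (A ⧸ m) hr) (Submodule.Quotient.mk 1)
  change Submodule.Quotient.mk (ι r • 1) = (0 : A ⧸ m) at this
  rwa [Submodule.Quotient.mk_eq_zero, smul_eq_mul, mul_one] at this

noncomputable section

/-! ### Semisimple Hopf algebras: integrals and finiteness -/

section Integral

variable {k H : Type*} [Field k] [Ring H] [HopfAlgebra k H]

/-- The augmentation ideal of a semisimple Hopf algebra has a complement; it is spanned by a
normalized left integral. -/
theorem exists_normalized_integral [IsSemisimpleRing H] :
    ∃ p : H, (∀ h : H, h * p = counit (R := k) h • p) ∧ counit (R := k) p = 1 := by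
  let I : Ideal H := RingHom.ker (Bialgebra.counitAlgHom k H)
  have mem_I : ∀ x : H, x ∈ I ↔ counit (R := k) x = 0 := fun x => Iff.rfl
  obtain ⟨L, hL⟩ := exists_isCompl I
  obtain ⟨q, hq, p, hp, hqp⟩ := Submodule.mem_sup.1
    (hL.sup_eq_top ▸ Submodule.mem_top : (1 : H) ∈ I ⊔ L)
  refine ⟨p, fun h => ?_, ?_⟩
  · have h1 : h * p - counit (R := k) h • p ∈ L := by
      refine L.sub_mem (L.mul_mem_left _ hp) ?_
      rw [Algebra.smul_def]
      exact L.mul_mem_left _ hp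
    have h2 : h * p - counit (R := k) h • p ∈ I := by
      rw [mem_I]
      simp
    have := Submodule.disjoint_def.1 hL.disjoint _ h2 h1
    exact sub_eq_zero.1 this
  · have := congrArg (counit (R := k)) hqp
    rwa [map_add, (mem_I q).1 hq, zero_add, Bialgebra.counit_one] at this

/-- If `p` is a left integral, then `∑ p₁ ⊗ S(p₂)` is a Casimir element. -/
theorem casimir_of_integral (p : H) (hp : ∀ h : H, h * p = counit (R := k) h • p) (h : H) :
    (h ⊗ₜ[k] 1) * (HopfAlgebra.antipode k (A := H)).lTensor H (comul p) =
      (HopfAlgebra.antipode k (A := H)).lTensor H (comul p) * (1 ⊗ₜ[k] h) := by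
  set S := HopfAlgebra.antipode k (A := H)
  set e := S.lTensor H (comul (R := k) p) with he
  let a : WithConv (H →ₗ[k] H ⊗[k] H) :=
    toConv ((LinearMap.mulRight k e) ∘ₗ
      (Algebra.TensorProduct.includeLeft : H →ₐ[k] H ⊗[k] H).toLinearMap)
  let b : WithConv (H →ₗ[k] H ⊗[k] H) :=
    toConv ((Algebra.TensorProduct.includeRight : H →ₐ[k] H ⊗[k] H).toLinearMap ∘ₗ S)
  let c : WithConv (H →ₗ[k] H ⊗[k] H) :=
    toConv ((Algebra.TensorProduct.includeRight : H →ₐ[k] H ⊗[k] H).toLinearMap ∘ₗ LinearMap.id)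
  have ha : ∀ x, a x = (x ⊗ₜ 1) * e := fun x => rfl
  have hb : ∀ x, b x = 1 ⊗ₜ S x := fun x => rfl
  have hc : ∀ x, c x = 1 ⊗ₜ x := fun x => rfl
  have hbc : b * c = 1 := by
    have := LinearMap.algHom_comp_convMul_distrib
      (Algebra.TensorProduct.includeRight : H →ₐ[k] H ⊗[k] H) (toConv S) (toConv LinearMap.id)
    rw [LinearMap.antipode_mul_id] at this
    apply WithConv.ofConv_injective
    rw [← show _ = (b * c).ofConv from this]
    ext x
    change (1 : H) ⊗ₜ[k] algebraMap k H (counit x) = algebraMap k (H ⊗[k] H) (counit x)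
    simp [Algebra.algebraMap_eq_smul_one, Algebra.TensorProduct.one_def]
  have hab : ∀ x, (a * b) x = counit (R := k) x • e := by
    intro x
    have h1 : S.lTensor H (comul (R := k) (x * p)) = counit (R := k) x • e := by
      rw [hp, map_smul, map_smul]
    rw [← h1, (ℛ k x).convMul_apply, Bialgebra.comul_mul]
    conv_rhs => rw [← (ℛ k x).eq, Finset.sum_mul, map_sum]
    refine Finset.sum_congr rfl fun i _ => ?_
    rw [ha, hb, he, ← (ℛ k p).eq, map_sum, Finset.mul_sum, Finset.mul_sum, Finset.sum_mul, map_sum]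
    refine Finset.sum_congr rfl fun j _ => ?_
    simp [S, HopfAlgebra.antipode_mul_antidistrib]
  have key : (a * b * c) h = a h := by rw [mul_assoc, hbc, mul_one]
  rw [ha, (ℛ k h).convMul_apply] at key
  rw [← key]
  conv_rhs => rw [← sum_counit_smul (ℛ k h)]
  simp [hab, hc, TensorProduct.tmul_sum, Finset.mul_sum]

/-- A semisimple Hopf algebra is separable, hence finite-dimensional: the left coefficients of the
Casimir element span a finite-dimensional left ideal `E`, and `H = ∑ E b` for finitely many `b`. -/
theorem finite_of_isSemisimpleRing [IsSemisimpleRing H] : Module.Finite k H := by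
  obtain ⟨p, hp, hp1⟩ := exists_normalized_integral (k := k) (H := H)
  set e := (HopfAlgebra.antipode k (A := H)).lTensor H (comul (R := k) p) with he
  have hcas := casimir_of_integral p hp
  rw [← he] at hcas
  have hmul : LinearMap.mul' k H e = 1 := by
    rw [he, HopfAlgebra.mul_antipode_lTensor_comul_apply, hp1, map_one]
  let slice : H ⊗[k] H →ₗ[k] (H →ₗ[k] k) →ₗ[k] H :=
    TensorProduct.lift (LinearMap.mk₂ k (fun a b => (LinearMap.applyₗ b).smulRight a)
      (fun a a' b => by ext; simp) (fun t a b => by ext f; exact smul_comm (f b) t a)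
      (fun a b b' => by ext; simp [add_smul]) (fun t a b => by ext; simp [mul_smul]))
  have slice_tmul : ∀ a b f, slice (a ⊗ₜ b) f = f b • a := fun a b f => rfl
  let E : Submodule k H := LinearMap.range (slice e)
  have hE : Module.Finite k E := by
    have : Module.Finite k
        (Submodule.span k (Set.range fun i : (ℛ k p).index => (ℛ k p).left i)) :=
      Module.Finite.span_of_finite k (Set.finite_range _)
    refine Submodule.finiteDimensional_of_le (S₂ :=
      Submodule.span k (Set.range fun i : (ℛ k p).index => (ℛ k p).left i)) ?_
    rintro _ ⟨f, rfl⟩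
    rw [he, ← (ℛ k p).eq, map_sum, map_sum, LinearMap.sum_apply]
    refine Submodule.sum_mem _ fun i hi => ?_
    rw [LinearMap.lTensor_tmul, slice_tmul]
    exact Submodule.smul_mem _ _ (Submodule.subset_span ⟨⟨i, hi⟩, rfl⟩)
  have hEideal : ∀ h : H, ∀ x ∈ E, h * x ∈ E := by
    rintro h _ ⟨f, rfl⟩
    refine ⟨f ∘ₗ LinearMap.mulRight k h, ?_⟩
    have h1 : ∀ y : H ⊗[k] H, slice ((h ⊗ₜ 1) * y) f = h * slice y f := by
      intro y
      induction y with
      | zero => simp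
      | add y z hy hz => simp [mul_add, hy, hz]
      | tmul a b => simp [slice_tmul]
    have h2 : ∀ y : H ⊗[k] H, slice (y * (1 ⊗ₜ h)) f = slice y (f ∘ₗ LinearMap.mulRight k h) := by
      intro y
      induction y with
      | zero => simp
      | add y z hy hz => simp [add_mul, hy, hz]
      | tmul a b => simp [slice_tmul]
    rw [← h1, ← h2, hcas]
  let B := Module.Basis.ofVectorSpace k H
  obtain ⟨c, hc⟩ := TensorProduct.eq_repr_basis_right B e
  have hcE : ∀ j, c j ∈ E := by
    classical
    intro j
    refine ⟨B.coord j, ?_⟩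
    rw [← hc, Finsupp.sum, map_sum, LinearMap.sum_apply]
    simp only [slice_tmul, Module.Basis.coord_apply, Module.Basis.repr_self, Finsupp.single_apply,
      ite_smul, one_smul, zero_smul, Finset.sum_ite_eq']
    split_ifs with h
    · rfl
    · exact (Finsupp.notMem_support_iff.1 h).symm
  let Ψ : (c.support → E) →ₗ[k] H :=
    ∑ j : c.support, LinearMap.mulRight k (B j) ∘ₗ E.subtype ∘ₗ LinearMap.proj j
  refine Module.Finite.of_surjective Ψ fun a => ⟨fun j => ⟨a * c j, hEideal a _ (hcE j)⟩, ?_⟩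
  calc Ψ _ = ∑ j : c.support, a * c j * B j := by simp [Ψ]
    _ = ∑ j ∈ c.support, a * (c j * B j) := by
      rw [← Finset.sum_coe_sort c.support]
      simp only [mul_assoc]
    _ = a * LinearMap.mul' k H e := by
      rw [← Finset.mul_sum, ← hc, Finsupp.sum, map_sum]
      simp
    _ = a := by rw [hmul, mul_one]

end Integral

/-! ### Characters of commutative algebras and group-like elements -/

theorem exists_algHom_of_isMaximal {k E : Type*} [Field k] [IsAlgClosed k] [CommRing E]
    [Algebra k E] [Module.Finite k E] (m : Ideal E) (hm : m.IsMaximal) :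
    ∃ χ : E →ₐ[k] k, ∀ x, χ x = 0 ↔ x ∈ m := by
  let : Field (E ⧸ m) := Ideal.Quotient.field m
  have hb : Function.Bijective (algebraMap k (E ⧸ m)) :=
    IsAlgClosed.algebraMap_bijective_of_isIntegral
  let e : k ≃ₐ[k] E ⧸ m := AlgEquiv.ofBijective (Algebra.ofId k (E ⧸ m)) hb
  refine ⟨e.symm.toAlgHom.comp (Ideal.Quotient.mkₐ k m), fun x => ?_⟩
  change e.symm (Ideal.Quotient.mk m x) = 0 ↔ x ∈ m
  rw [map_eq_zero_iff _ e.symm.injective, Ideal.Quotient.eq_zero_iff_mem]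

theorem tmul_ext_of_dual {k C D : Type*} [Field k] [AddCommGroup C] [Module k C]
    [AddCommGroup D] [Module k D] {x y : C ⊗[k] D}
    (h : ∀ (f : C →ₗ[k] k) (g : D →ₗ[k] k),
      LinearMap.mul' k k (TensorProduct.map f g x) =
        LinearMap.mul' k k (TensorProduct.map f g y)) : x = y := by
  let b := Module.Basis.ofVectorSpace k C
  let b' := Module.Basis.ofVectorSpace k D
  have key : ∀ (z : C ⊗[k] D) i j, (b.tensorProduct b').repr z (i, j) =
      LinearMap.mul' k k (TensorProduct.map (b.coord i) (b'.coord j) z) := by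
    intro z i j
    induction z with
    | zero => simp
    | add z w hz hw => simp [hz, hw]
    | tmul c d => simp [mul_comm]
  apply (b.tensorProduct b').repr.injective
  ext ⟨i, j⟩
  rw [key, key, h]

section GroupLike

variable {k C : Type*} [Field k] [AddCommGroup C] [Module k C] [Coalgebra k C]

theorem isSubcoalgebra_span_of_isGroupLikeElem {g : C} (hg : IsGroupLikeElem k g) :
    IsSubcoalgebra (Submodule.span k {g}) := by
  intro x hx
  obtain ⟨t, rfl⟩ := Submodule.mem_span_singleton.1 hx
  refine ⟨t • (⟨g, Submodule.mem_span_singleton_self g⟩ ⊗ₜ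
    ⟨g, Submodule.mem_span_singleton_self g⟩), ?_⟩
  simp [hg.comul_eq_tmul_self]

theorem IsSimpleSubcoalgebra.eq_span {D : Submodule k C} (hD : IsSimpleSubcoalgebra D) {g : C}
    (hg : IsGroupLikeElem k g) (hgD : g ∈ D) : D = Submodule.span k {g} := by
  rcases hD.2.2 _ (isSubcoalgebra_span_of_isGroupLikeElem hg)
    ((Submodule.span_singleton_le_iff_mem _ _).2 hgD) with h | h
  · exact absurd (Submodule.span_singleton_eq_bot.1 h) hg.ne_zero
  · exact h.symm

/-- The functionals vanishing on `D` form a proper ideal of the commutative dual algebra; a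
character of the quotient is evaluation at a group-like element of `D`. -/
theorem IsSimpleSubcoalgebra.exists_isGroupLikeElem [IsAlgClosed k] [IsCocomm k C]
    [Module.Finite k C] {D : Submodule k C} (hD : IsSimpleSubcoalgebra D) :
    ∃ g ∈ D, IsGroupLikeElem k g := by
  let I : Ideal (WithConv (C →ₗ[k] k)) :=
    { carrier := {f | ∀ x ∈ D, f x = 0}
      zero_mem' := fun x _ => rfl
      add_mem' := fun {f g} hf hg x hx => by
        change f x + g x = 0
        rw [hf x hx, hg x hx, add_zero]
      smul_mem' := fun a f hf x hx => by
        obtain ⟨y, hy⟩ := hD.1 x hx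
        have hy0 : ∀ y : D ⊗[k] D, LinearMap.mul' k k (TensorProduct.map a.ofConv f.ofConv
            (TensorProduct.map D.subtype D.subtype y)) = 0 := by
          intro y
          induction y with
          | zero => simp
          | add y z hy hz => simp only [map_add, hy, hz, add_zero]
          | tmul y z =>
            simp only [TensorProduct.map_tmul, LinearMap.mul'_apply, Submodule.subtype_apply]
            exact mul_eq_zero_of_right _ (hf z z.2)
        rw [smul_eq_mul, LinearMap.convMul_apply, ← hy, hy0] }
  have hI : I ≠ ⊤ := by
    intro h
    obtain ⟨x, hx, hx0⟩ := Submodule.exists_mem_ne_zero_of_ne_bot hD.2.1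
    refine hx0 ((Module.forall_dual_apply_eq_zero_iff k x).1 fun f => ?_)
    have : toConv f ∈ I := h ▸ Submodule.mem_top
    exact this x hx
  obtain ⟨m, hm, hIm⟩ := Ideal.exists_le_maximal I hI
  have : Module.Finite k (WithConv (C →ₗ[k] k)) :=
    Module.Finite.equiv (WithConv.linearEquiv k (C →ₗ[k] k)).symm
  obtain ⟨χ, hχ⟩ := exists_algHom_of_isMaximal (k := k) m hm
  let g : C := (Module.evalEquiv k C).symm
    (χ.toLinearMap ∘ₗ (WithConv.linearEquiv k (C →ₗ[k] k)).symm.toLinearMap)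
  have hg : ∀ f : WithConv (C →ₗ[k] k), f g = χ f := by
    intro f
    have := LinearMap.congr_fun ((Module.evalEquiv k C).apply_symm_apply
      (χ.toLinearMap ∘ₗ (WithConv.linearEquiv k (C →ₗ[k] k)).symm.toLinearMap)) f.ofConv
    exact this
  refine ⟨g, ?_, ?_, ?_⟩
  · by_contra hgD
    obtain ⟨f, hf, hfD⟩ := Submodule.exists_le_ker_of_notMem hgD
    refine hf ?_
    have : toConv f ∈ m := hIm fun x hx => hfD hx
    exact (hg (toConv f)).trans ((hχ _).2 this)
  · have := hg 1
    rwa [map_one] at this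
  · refine tmul_ext_of_dual fun f f' => ?_
    have := hg (toConv f * toConv f')
    rw [map_mul, ← hg, ← hg] at this
    exact this

theorem span_groupLike_eq_top [IsAlgClosed k] [IsCocomm k C] [Module.Finite k C]
    (h : IsCosemisimple k C) : Submodule.span k (Set.range (GroupLike.val (R := k) (A := C))) = ⊤ := by
  rw [eq_top_iff, ← h]
  refine sSup_le fun D hD => ?_
  obtain ⟨g, hgD, hg⟩ := IsSimpleSubcoalgebra.exists_isGroupLikeElem hD
  rw [IsSimpleSubcoalgebra.eq_span hD hg hgD]
  exact Submodule.span_mono (Set.singleton_subset_iff.2 ⟨⟨g, hg⟩, rfl⟩)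

theorem finite_groupLike [Module.Finite k C] : Finite (GroupLike k C) :=
  (linearIndep_groupLikeVal (R := k) (A := C)).finite_of_isNoetherian

end GroupLike

/-- In a semisimple group algebra the order of the group is invertible: a normalized integral is a
multiple of the sum of all group elements. -/
theorem card_groupLike_ne_zero {k H : Type*} [Field k] [Ring H] [HopfAlgebra k H]
    [IsSemisimpleRing H] [Fintype (GroupLike k H)] (b : Module.Basis (GroupLike k H) k H)
    (hb : ∀ g, b g = g.val) : (Fintype.card (GroupLike k H) : k) ≠ 0 := by
  obtain ⟨p, hp, hp1⟩ := exists_normalized_integral (k := k) (H := H)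
  have hrepr : ∀ h x, b.repr (h.val * x) h = b.repr x 1 := by
    intro h x
    have : b.coord h ∘ₗ LinearMap.mulLeft k h.val = b.coord 1 := by
      refine b.ext fun g => ?_
      have : h.val * b g = b (h * g) := by rw [hb, hb, GroupLike.val_mul]
      rw [LinearMap.comp_apply, LinearMap.mulLeft_apply, this]
      simp only [Module.Basis.coord_apply, Module.Basis.repr_self]
      by_cases hg : g = 1
      · simp [hg]
      · rw [Finsupp.single_eq_of_ne (by simpa using hg),
          Finsupp.single_eq_of_ne (Ne.symm hg)]
    exact LinearMap.congr_fun this x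
  have hcoef : ∀ h, b.repr p h = b.repr p 1 := by
    intro h
    rw [← hrepr h p, hp, h.isGroupLikeElem_val.counit_eq_one, one_smul]
  intro h0
  have := b.sum_repr p
  simp only [hcoef, ← Finset.smul_sum] at this
  have h2 := congrArg (counit (R := k)) this
  rw [map_smul, map_sum, hp1] at h2
  simp only [hb, fun g : GroupLike k H => g.isGroupLikeElem_val.counit_eq_one] at h2
  simp [h0] at h2

/-! ### Characters of commutative semisimple Hopf algebras -/

section Characters

variable {k H : Type*} [Field k] [IsAlgClosed k] [CommRing H] [HopfAlgebra k H]
  [IsSemisimpleRing H]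

omit [IsAlgClosed k] in
theorem finite_characters : Finite (WithConv (H →ₐ[k] k)) := by
  have := finite_of_isSemisimpleRing (k := k) (H := H)
  have : Finite (H →ₐ[k] k) :=
    (linearIndependent_algHom_toLinearMap k H k).finite_of_isNoetherian
  exact Finite.of_equiv _ (WithConv.equiv (H →ₐ[k] k)).symm

theorem eq_zero_of_characters {x : H} (hx : ∀ χ : WithConv (H →ₐ[k] k), χ x = 0) : x = 0 := by
  have := finite_of_isSemisimpleRing (k := k) (H := H)
  have hJ := IsSemisimpleRing.jacobson_eq_bot H
  rw [← Submodule.mem_bot H, ← hJ, Ring.jacobson_eq_sInf_isMaximal, Submodule.mem_sInf]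
  intro m hm
  obtain ⟨χ, hχ⟩ := exists_algHom_of_isMaximal (k := k) m hm
  exact (hχ x).1 (hx (toConv χ))

omit [IsAlgClosed k] in
/-- A normalized integral is the indicator of the trivial character. -/
theorem exists_dual_trivial_character [DecidableEq (WithConv (H →ₐ[k] k))] :
    ∃ p : H, ∀ χ : WithConv (H →ₐ[k] k), χ p = if χ = 1 then 1 else 0 := by
  obtain ⟨p, hp, hp1⟩ := exists_normalized_integral (k := k) (H := H)
  refine ⟨p, fun χ => ?_⟩
  split_ifs with h
  · rw [h, AlgHom.convOne_apply, hp1, map_one]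
  · by_contra hne
    refine h (WithConv.ofConv_injective (AlgHom.ext fun x => ?_))
    have h1 : χ.ofConv (x * p) = χ.ofConv (counit (R := k) x • p) := by rw [hp]
    rw [map_mul, map_smul, smul_eq_mul] at h1
    exact mul_right_cancel₀ hne h1

/-- Dual to `card_groupLike_ne_zero`. The sum `T` of all characters is an integral of the dual
algebra; if it kills `1`, then it vanishes on every simple subcoalgebra. -/
theorem card_characters_ne_zero [Fintype (WithConv (H →ₐ[k] k))] (hco : IsCosemisimple k H) :
    (Fintype.card (WithConv (H →ₐ[k] k)) : k) ≠ 0 := by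
  classical
  intro h0
  let T : H →ₗ[k] k := ∑ χ : WithConv (H →ₐ[k] k), χ.ofConv.toLinearMap
  have T_apply : ∀ h, T h = ∑ χ : WithConv (H →ₐ[k] k), χ h := by
    intro h
    simp only [T, LinearMap.sum_apply]
    rfl
  have T_one : T 1 = 0 := by
    rw [T_apply, ← h0, Fintype.card, Finset.cast_card]
    exact Finset.sum_congr rfl fun χ _ => map_one χ.ofConv
  have T_int : ∀ h, TensorProduct.rid k H (T.lTensor H (comul h)) = T h • (1 : H) := by
    intro h
    rw [← sub_eq_zero]
    refine eq_zero_of_characters (k := k) fun χ => ?_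
    change χ.ofConv (_ - _) = 0
    rw [map_sub, sub_eq_zero, map_smul, map_one, T_apply,
      ← Equiv.sum_comp (Equiv.mulLeft χ) fun η => η h, ← (ℛ k h).eq]
    simp only [map_sum, LinearMap.lTensor_tmul, TensorProduct.rid_tmul, map_smul, T_apply,
      Equiv.coe_mulLeft, smul_eq_mul, mul_one, Finset.sum_mul]
    rw [Finset.sum_comm]
    refine Finset.sum_congr rfl fun η _ => ?_
    rw [AlgHom.convMul_apply, ← (ℛ k h).eq]
    simp only [map_sum]
    exact Finset.sum_congr rfl fun i _ => mul_comm _ _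
  have T_simple : ∀ D : Submodule k H, IsSimpleSubcoalgebra D → D ≤ LinearMap.ker T := by
    intro D hD d hd
    rw [LinearMap.mem_ker]
    by_contra hne
    have h1 : (1 : H) ∈ D := by
      have : T d • (1 : H) ∈ D := by
        rw [← T_int]
        obtain ⟨y, hy⟩ := hD.1 d hd
        rw [← hy]
        clear hy
        induction y with
        | zero => simp
        | add y z hy hz =>
          simp only [map_add]
          exact D.add_mem hy hz
        | tmul y z => simpa using D.smul_mem _ y.2
      exact (D.smul_mem_iff hne).1 this
    rw [hD.eq_span IsGroupLikeElem.one h1] at hd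
    obtain ⟨t, rfl⟩ := Submodule.mem_span_singleton.1 hd
    rw [map_smul, T_one, smul_zero] at hne
    exact hne rfl
  obtain ⟨p, hp⟩ := exists_dual_trivial_character (k := k) (H := H)
  have hTp : T p = 1 := by
    rw [T_apply]
    simp [hp]
  have : p ∈ LinearMap.ker T := by
    have h2 : (⊤ : Submodule k H) ≤ LinearMap.ker T := by
      rw [← hco]
      exact sSup_le T_simple
    exact h2 Submodule.mem_top
  rw [LinearMap.mem_ker, hTp] at this
  exact one_ne_zero this

end Characters

/-! ### Elements of the crossed product -/

theorem sum_counit_smul_left {k C κ : Type*} [Field k] [AddCommGroup C] [Module k C]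
    [Coalgebra k C] {c : C} (r : Coalgebra.Repr k c κ) :
    ∑ i ∈ r.index, counit (R := k) (r.right i) • r.left i = c := by
  have := congrArg (TensorProduct.rid k C) (sum_tmul_counit_eq r)
  simpa only [map_sum, TensorProduct.rid_tmul, one_smul] using this

namespace TwistedModuleAlgebra

universe u v w

section Elements

variable {k : Type u} {H : Type v} {R : Type w} [Field k] [Ring H] [HopfAlgebra k H]
  [Ring R] [Algebra k R] (S : TwistedModuleAlgebra k H R)

@[elab_as_elim]
theorem CrossedProduct.induction {motive : S.CrossedProduct → Prop} (x : S.CrossedProduct)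
    (zero : motive 0) (elt : ∀ a h, motive (S.elt a h))
    (add : ∀ x y, motive x → motive y → motive (x + y)) : motive x :=
  TensorProduct.induction_on (motive := motive) x zero elt add

theorem elt_one_mul (a : R) (x : S.CrossedProduct) :
    S.elt a 1 * x = ((a ⊗ₜ[k] 1 : R ⊗[k] H) * (show R ⊗[k] H from x) : R ⊗[k] H) := by
  have h := S.mulMap_left a (1 ⊗ₜ 1) x
  rw [← Algebra.TensorProduct.one_def, mul_one] at h
  exact h.trans (congrArg _ (S.one_mulMap x))

/-- The embedding `a ↦ a # 1` of `R` into the crossed product. -/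
def ι : R →ₐ[k] S.CrossedProduct :=
  AlgHom.ofLinearMap
    ({ toFun := fun a => S.elt a 1
       map_add' := fun a b => TensorProduct.add_tmul a b 1
       map_smul' := fun t a => (TensorProduct.smul_tmul' t a 1).symm } : R →ₗ[k] S.CrossedProduct)
    rfl (fun a b => by
      change S.elt (a * b) 1 = S.elt a 1 * S.elt b 1
      rw [elt_one_mul]
      change _ = (a ⊗ₜ[k] (1 : H)) * (b ⊗ₜ[k] (1 : H))
      rw [Algebra.TensorProduct.tmul_mul_tmul, one_mul]
      rfl)

/-- The linear map `h ↦ 1 # h`. -/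
def γ : H →ₗ[k] S.CrossedProduct := TensorProduct.mk k R H 1

theorem ι_apply (a : R) : S.ι a = S.elt a 1 := rfl

theorem γ_apply (h : H) : S.γ h = S.elt 1 h := rfl

theorem γ_one : S.γ 1 = 1 := rfl

theorem ι_mul_elt (a b : R) (h : H) : S.ι a * S.elt b h = S.elt (a * b) h := by
  rw [ι_apply, elt_one_mul]
  change (a ⊗ₜ[k] (1 : H)) * (b ⊗ₜ[k] h) = _
  rw [Algebra.TensorProduct.tmul_mul_tmul, one_mul]
  rfl

theorem elt_eq (a : R) (h : H) : S.elt a h = S.ι a * S.γ h := by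
  rw [γ_apply, ι_mul_elt, mul_one]

theorem γ_mul_ι_repr {κ : Type*} (h : H) (b : R) (r : Coalgebra.Repr k h κ) :
    S.γ h * S.ι b = ∑ i ∈ r.index, S.elt (S.act (r.left i) b) (r.right i) := by
  change S.mulMap (1 ⊗ₜ h) (b ⊗ₜ 1) = _
  have key : ∀ h : H, S.twist (h ⊗ₜ 1) = 1 ⊗ₜ h := by
    intro h
    have := S.mulMap_tmul 1 1 h 1
    rw [mulMap_one, ← Algebra.TensorProduct.one_def, one_mul, mulAux_tmul] at this
    rw [this]
    simp only [act_one]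
    conv_lhs => rw [← sum_counit_smul (ℛ k h)]
    simp only [TensorProduct.sum_tmul, map_sum, ← TensorProduct.smul_tmul', map_smul, smul_mul_assoc,
      ← Algebra.TensorProduct.one_def, one_mul]
  rw [mulMap_tmul, ← Algebra.TensorProduct.one_def, one_mul, mulAux, extendCounit_mul_repr _ _ _ _ r]
  refine Finset.sum_congr rfl fun i _ => ?_
  rw [key, inl_apply, actOn_apply, Algebra.TensorProduct.tmul_mul_tmul, mul_one, one_mul]
  rfl

theorem γ_mul_γ_repr {κ κ' : Type*} (h l : H) (r : Coalgebra.Repr k h κ)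
    (s : Coalgebra.Repr k l κ') : S.γ h * S.γ l = ∑ i ∈ r.index, ∑ j ∈ s.index,
      S.elt (S.σ.val (r.left i ⊗ₜ s.left j)) (r.right i * s.right j) := by
  have h1 : S.mulAux 1 = S.twist := by
    have : extendCounit H (inl (S.actOn 1)) =
        (1 : WithConv (H ⊗[k] H →ₗ[k] R ⊗[k] H)) := by
      ext x y
      simp [act_one, Algebra.TensorProduct.one_def, Algebra.algebraMap_eq_smul_one, smul_smul,
        TensorProduct.smul_tmul', mul_comm]
    rw [mulAux, this, one_mul]
  change S.mulMap (1 ⊗ₜ h) (1 ⊗ₜ l) = _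
  rw [mulMap_tmul, ← Algebra.TensorProduct.one_def, one_mul, h1, twist, (r.tmul s).convMul_apply,
    Repr.tmul_index, Finset.sum_product]
  refine Finset.sum_congr rfl fun i _ => Finset.sum_congr rfl fun j _ => ?_
  simp only [Repr.tmul_left, Repr.tmul_right, inl_apply, inr_apply, LinearMap.mul'_apply,
    Algebra.TensorProduct.tmul_mul_tmul, mul_one, one_mul]
  rfl

/-- The left `R`-linear map `a # h ↦ f(h) a`. -/
def slice (f : H →ₗ[k] k) : S.CrossedProduct →ₗ[k] R :=
  (TensorProduct.rid k R).toLinearMap ∘ₗ f.lTensor R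

theorem slice_elt (f : H →ₗ[k] k) (a : R) (h : H) : S.slice f (S.elt a h) = f h • a := rfl

theorem slice_ι_mul (f : H →ₗ[k] k) (a : R) (x : S.CrossedProduct) :
    S.slice f (S.ι a * x) = a * S.slice f x := by
  induction x using CrossedProduct.induction with
  | zero => simp
  | elt b h => rw [ι_mul_elt, slice_elt, slice_elt, mul_smul_comm]
  | add x y hx hy => rw [mul_add, map_add, map_add, hx, hy, mul_add]

theorem slice_counit_ι (a : R) : S.slice counit (S.ι a) = a := by
  rw [ι_apply, slice_elt, Bialgebra.counit_one, one_smul]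

theorem slice_mem {I : Ideal R} {x : S.CrossedProduct} (hx : x ∈ S.idealCrossed I)
    (f : H →ₗ[k] k) : S.slice f x ∈ I := by
  induction hx using Submodule.span_induction with
  | mem x hx =>
    obtain ⟨a, ha, h, rfl⟩ := hx
    rw [slice_elt, Algebra.smul_def]
    exact I.mul_mem_left _ ha
  | zero => simp
  | add x y _ _ hx hy => rw [map_add]; exact I.add_mem hx hy
  | smul t x _ hx =>
    rw [map_smul, Algebra.smul_def]
    exact I.mul_mem_left _ hx

theorem ι_mul_mem_idealCrossed {I : Ideal R} [I.IsTwoSided] {r : R} (hr : r ∈ I)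
    (x : S.CrossedProduct) : S.ι r * x ∈ S.idealCrossed I := by
  induction x using CrossedProduct.induction with
  | zero => simp
  | elt b h =>
    rw [ι_mul_elt]
    exact Submodule.subset_span ⟨_, I.mul_mem_right _ hr, h, rfl⟩
  | add x y hx hy => rw [mul_add]; exact Submodule.add_mem _ hx hy

/-! ### `R`-`H`-modules are modules over the crossed product -/

/-- The action of the crossed product on an `R`-`H`-module, `(a # h) m = a (h m)`. -/
def RHModule.toEnd {S : TwistedModuleAlgebra k H R} {M : Type*} [AddCommGroup M] [Module k M]
    [Module R M] [IsScalarTower k R M] (V : S.RHModule M) : S.CrossedProduct →+* Module.End k M :=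
  let f : S.CrossedProduct →ₗ[k] Module.End k M :=
    TensorProduct.lift (LinearMap.mk₂ k (fun a h => Algebra.lsmul k k M a ∘ₗ V.hact h)
      (fun a b h => by ext m; simp) (fun t a h => by ext m; simp)
      (fun a h l => by ext m; simp) (fun t a h => by
        ext m
        change a • V.hact (t • h) m = t • a • V.hact h m
        rw [map_smul, LinearMap.smul_apply, smul_comm]))
  have f_elt : ∀ a h m, f (S.elt a h) m = a • V.hact h m := fun a h m => rfl
  { f with
    map_one' := by
      ext m
      change f (S.elt 1 1) m = m
      rw [f_elt, V.one_hact, one_smul]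
    map_zero' := map_zero f
    map_mul' := fun x y => by
      change f (x * y) = f x * f y
      induction x using CrossedProduct.induction with
      | zero => simp
      | add x x' hx hx' => rw [add_mul, map_add, map_add, hx, hx', add_mul]
      | elt a h =>
        induction y using CrossedProduct.induction with
        | zero => simp
        | add y y' hy hy' => rw [mul_add, map_add, map_add, hy, hy', mul_add]
        | elt b l =>
          ext m
          rw [elt_mul_elt, Module.End.mul_apply, f_elt, f_elt, V.hact_smul]
          simp only [map_sum, LinearMap.sum_apply, f_elt, V.hact_hact, Finset.smul_sum, smul_smul,
            mul_assoc] }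

theorem RHModule.IsIrreducible.ι_mem_annihilator {S : TwistedModuleAlgebra k H R} {M : Type*}
    [AddCommGroup M] [Module k M] [Module R M] [IsScalarTower k R M] {V : S.RHModule M}
    (hV : V.IsIrreducible) {a : R} (ha : S.ι a ∈ Ring.jacobson S.CrossedProduct) (m : M) :
    a • m = 0 := by
  let : Module S.CrossedProduct M := Module.compHom M V.toEnd
  have smul_elt : ∀ a h (m : M), S.elt a h • m = a • V.hact h m := fun a h m => rfl
  have : IsSimpleModule S.CrossedProduct M := by
    obtain ⟨⟨b, m, hbm⟩, hN⟩ := hV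
    have : Nontrivial M := ⟨_, _, hbm⟩
    refine { eq_bot_or_eq_top := fun N => ?_, toNontrivial := inferInstance }
    let N' : Submodule R M :=
      { N.toAddSubmonoid with
        smul_mem' := fun r n hn => by
          have := N.smul_mem (S.elt r 1) hn
          rwa [smul_elt, V.one_hact] at this }
    refine (hN N' fun h m hm => ?_).imp (fun h => ?_) (fun h => ?_)
    · have := N.smul_mem (S.elt 1 h) hm
      rwa [smul_elt, one_smul] at this
    · ext m
      have : m ∈ N' ↔ m ∈ (⊥ : Submodule R M) := by rw [h]
      exact this
    · ext m
      have : m ∈ N' ↔ m ∈ (⊤ : Submodule R M) := by rw [h]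
      exact this
  have := Module.mem_annihilator.1 (IsSemisimpleModule.jacobson_le_annihilator _ M ha) m
  rwa [ι_apply, smul_elt, V.one_hact] at this

/-- The simple quotient of the crossed product by a maximal left ideal `m` is an irreducible
`R`-`H`-module, in the universe used for `hJacobson`. The annihilator kills the class of `1`, so it
lies in `m`. -/
theorem exists_irreducible_of_isMaximal (m : Ideal S.CrossedProduct) (hm : m.IsMaximal) :
    ∃ (M : Type (max v w)) (_ : AddCommGroup M) (_ : Module k M) (_ : Module R M)
      (_ : IsScalarTower k R M) (V : S.RHModule M), V.IsIrreducible ∧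
        ∀ a ∈ Module.annihilator R M, S.ι a ∈ m := by
  let : Module R (S.CrossedProduct ⧸ m) := Module.compHom _ S.ι.toRingHom
  have smul_def : ∀ (r : R) (x : S.CrossedProduct ⧸ m), r • x = S.ι r • x := fun _ _ => rfl
  have : IsScalarTower k R (S.CrossedProduct ⧸ m) :=
    ⟨fun t r x => by rw [smul_def, smul_def, map_smul, smul_assoc]⟩
  have : IsSimpleModule S.CrossedProduct (S.CrossedProduct ⧸ m) :=
    isSimpleModule_iff_isCoatom.2 (Ideal.isMaximal_def.1 hm)
  let V : S.RHModule (S.CrossedProduct ⧸ m) :=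
    { hact := (Algebra.lsmul k k (S.CrossedProduct ⧸ m)).toLinearMap ∘ₗ S.γ
      one_hact := fun x => by
        change S.γ 1 • x = x
        rw [γ_one, one_smul]
      hact_smul := fun h a x => by
        change S.γ h • S.ι a • x = ∑ i ∈ (ℛ k h).index,
          S.ι (S.act ((ℛ k h).left i) a) • S.γ ((ℛ k h).right i) • x
        rw [smul_smul, S.γ_mul_ι_repr h a (ℛ k h), Finset.sum_smul]
        simp only [elt_eq, mul_smul]
      hact_hact := fun h l x => by
        change S.γ h • S.γ l • x = ∑ i ∈ (ℛ k h).index, ∑ j ∈ (ℛ k l).index,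
          S.ι (S.σ.val ((ℛ k h).left i ⊗ₜ (ℛ k l).left j)) •
            S.γ ((ℛ k h).right i * (ℛ k l).right j) • x
        rw [smul_smul, S.γ_mul_γ_repr h l (ℛ k h) (ℛ k l), Finset.sum_smul]
        simp only [elt_eq, mul_smul, Finset.sum_smul] }
  have hact_def : ∀ h x, V.hact h x = S.γ h • x := fun _ _ => rfl
  have := IsSimpleModule.nontrivial S.CrossedProduct (S.CrossedProduct ⧸ m)
  refine ⟨S.CrossedProduct ⧸ m, inferInstance, inferInstance, inferInstance, inferInstance, V,
    ⟨?_, fun N hN => ?_⟩, fun a ha => ?_⟩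
  · obtain ⟨x, hx⟩ := exists_ne (0 : S.CrossedProduct ⧸ m)
    exact ⟨1, x, by rwa [one_smul]⟩
  · let N' : Submodule S.CrossedProduct (S.CrossedProduct ⧸ m) :=
      { N.toAddSubmonoid with
        smul_mem' := fun y x hx => by
          change y • x ∈ N
          induction y using CrossedProduct.induction with
          | zero => rw [zero_smul]; exact N.zero_mem
          | add y z hy hz => rw [add_smul]; exact N.add_mem hy hz
          | elt a h =>
            rw [elt_eq, mul_smul, ← smul_def, ← hact_def]
            exact N.smul_mem _ (hN h x hx) }
    refine (eq_bot_or_eq_top N').imp (fun h => ?_) (fun h => ?_)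
    · ext x
      have : x ∈ N' ↔ x ∈ (⊥ : Submodule S.CrossedProduct _) := by rw [h]
      exact this
    · ext x
      have : x ∈ N' ↔ x ∈ (⊤ : Submodule S.CrossedProduct _) := by rw [h]
      exact this
  · have := Module.mem_annihilator.1 ha (Submodule.Quotient.mk 1)
    rwa [smul_def, ← Submodule.Quotient.mk_smul, Submodule.Quotient.mk_eq_zero, smul_eq_mul,
      mul_one] at this

/-- `r_{Hj}(R)` is the intersection of `R` with the Jacobson radical of the crossed product. -/
theorem mem_hJacobson_iff (a : R) :
    a ∈ S.hJacobson ↔ S.ι a ∈ Ring.jacobson S.CrossedProduct := by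
  rw [hJacobson, Submodule.mem_sInf]
  constructor
  · intro h
    rw [Ring.jacobson_eq_sInf_isMaximal, Submodule.mem_sInf]
    intro m hm
    obtain ⟨M, i1, i2, i3, i4, V, hV, ha⟩ := S.exists_irreducible_of_isMaximal m hm
    exact ha a (h _ ⟨M, i1, i2, i3, i4, V, hV, rfl⟩)
  · rintro ha _ ⟨M, i1, i2, i3, i4, V, hV, rfl⟩
    exact Module.mem_annihilator.2 fun m => hV.ι_mem_annihilator ha m

/-! ### Comparison of the radicals -/

/-- All equalities of radicals follow once the radical of the crossed product is generated by the
radical of the base ring. -/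
theorem radicals_eq (h₁ : ∀ r ∈ Ring.jacobson R, S.ι r ∈ Ring.jacobson S.CrossedProduct)
    (h₂ : ∀ x ∈ Ring.jacobson S.CrossedProduct, x ∈ S.idealCrossed (Ring.jacobson R)) :
    Ring.jacobson R = S.hJacobson ∧ S.hJacobson = S.jacobsonH ∧
      (Ring.jacobson S.CrossedProduct : Set S.CrossedProduct) = S.idealCrossed S.hJacobson := by
  have e1 : Ring.jacobson R = S.hJacobson := by
    ext r
    rw [mem_hJacobson_iff]
    refine ⟨h₁ r, fun hr => ?_⟩
    rw [← S.slice_counit_ι r]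
    exact S.slice_mem (h₂ _ hr) counit
  have e2 : Ring.jacobson R = S.jacobsonH := by
    ext r
    constructor
    · intro hr h
      have h3 : S.slice counit (S.γ h * S.ι r) = S.act h r := by
        rw [S.γ_mul_ι_repr h r (ℛ k h), map_sum]
        simp only [slice_elt]
        conv_rhs => rw [← sum_counit_smul_left (ℛ k h)]
        simp
      rw [← h3]
      exact S.slice_mem (h₂ _ (Ideal.mul_mem_left _ _ (h₁ r hr))) counit
    · intro hr
      have := hr 1
      rwa [S.one_act] at this
  refine ⟨e1, e1.symm.trans e2, ?_⟩
  rw [← e1]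
  refine Set.Subset.antisymm h₂ ?_
  intro x hx
  change x ∈ S.idealCrossed _ at hx
  induction hx using Submodule.span_induction with
  | mem x hx =>
    obtain ⟨a, ha, h, rfl⟩ := hx
    rw [elt_eq]
    exact Ideal.mul_mem_right _ _ (h₁ a ha)
  | zero => exact Ideal.zero_mem _
  | add x y _ _ hx hy => exact Ideal.add_mem _ hx hy
  | smul t x _ hx =>
    rw [Algebra.smul_def]
    exact Ideal.mul_mem_left _ _ hx

end Elements

section General

variable {k : Type u} {H : Type v} {R : Type w} [Field k] [Ring H] [HopfAlgebra k H]
  [Ring R] [Algebra k R] (S : TwistedModuleAlgebra k H R)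

/-! ### Intersection of the radical with the base ring -/

/-- An element of `R` that is invertible in the crossed product is invertible in `R`: applying
`a # h ↦ ε(h) a` to its inverse gives a right inverse in `R`, which is the inverse by uniqueness. -/
theorem isUnit_of_isUnit_ι {r : R} (hr : IsUnit (S.ι r)) : IsUnit r := by
  obtain ⟨z, hz, hz'⟩ := isUnit_iff_exists.1 hr
  have hs : r * S.slice counit z = 1 := by
    rw [← S.slice_ι_mul, hz, ← map_one S.ι, slice_counit_ι]
  have hsz : z = S.ι (S.slice counit z) := left_inv_eq_right_inv hz' (by rw [← map_mul, hs, map_one])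
  refine isUnit_iff_exists.2 ⟨_, hs, ?_⟩
  rw [hsz, ← map_mul] at hz'
  rw [← S.slice_counit_ι (_ * r), hz', ← map_one S.ι, slice_counit_ι]

theorem mem_jacobson_of_ι_mem {r : R} (hr : S.ι r ∈ Ring.jacobson S.CrossedProduct) :
    r ∈ Ring.jacobson R := by
  have left_inv : ∀ y ∈ Ring.jacobson S.CrossedProduct, ∃ z, z * (1 + y) = 1 := by
    intro y hy
    rw [← Ideal.jacobson_bot, Ideal.mem_jacobson_iff] at hy
    obtain ⟨z, hz⟩ := hy 1
    rw [mul_one, Submodule.mem_bot, sub_eq_zero] at hz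
    exact ⟨z, by rw [mul_add, mul_one, add_comm, hz]⟩
  rw [← Ideal.jacobson_bot, Ideal.mem_jacobson_iff]
  intro y
  have hi : S.ι (y * r) ∈ Ring.jacobson S.CrossedProduct := by
    rw [map_mul]
    exact Ideal.mul_mem_left _ _ hr
  obtain ⟨z, hz⟩ := left_inv _ hi
  -- `z = 1 - z (y r)` is itself of the form `1 + j` with `j` in the radical
  obtain ⟨t, ht⟩ := left_inv (-(z * S.ι (y * r)))
    (Ideal.neg_mem_iff _ |>.2 (Ideal.mul_mem_left _ _ hi))
  rw [show 1 + -(z * S.ι (y * r)) = z by rw [← hz]; simp [mul_add]] at ht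
  have hz' : (1 + S.ι (y * r)) * z = 1 := by rw [← left_inv_eq_right_inv ht hz, ht]
  obtain ⟨s, hs, hs'⟩ := isUnit_iff_exists.1 (S.isUnit_of_isUnit_ι (r := 1 + y * r)
    (isUnit_iff_exists.2 ⟨z, by rw [map_add, map_one, hz'], by rw [map_add, map_one, hz]⟩))
  refine ⟨s, ?_⟩
  rw [Submodule.mem_bot, sub_eq_zero, mul_assoc, ← hs', mul_add, mul_one, add_comm]

/-! ### A left convolution inverse of `γ` -/

/-- The identity `γ(h l) = ∑ σ⁻¹(h₁, l₁) γ(h₂) γ(l₂)`, applied to `S(h₁)` and `h₂`, turns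
`γ(S(h₁) h₂) = ε(h)` into a left convolution inverse of `γ`. -/
theorem exists_leftInverse_γ : ∃ β : WithConv (H →ₗ[k] S.CrossedProduct),
    β * toConv S.γ = 1 := by
  let ισ : WithConv (H ⊗[k] H →ₗ[k] S.CrossedProduct) := toConv (S.ι.toLinearMap ∘ₗ S.σ.val.ofConv)
  let ισ' : WithConv (H ⊗[k] H →ₗ[k] S.CrossedProduct) :=
    toConv (S.ι.toLinearMap ∘ₗ S.σ⁻¹.val.ofConv)
  have hσ : ισ' * ισ = 1 := by
    have h := LinearMap.algHom_comp_convMul_distrib S.ι S.σ⁻¹.val S.σ.val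
    rw [Units.inv_mul] at h
    apply WithConv.ofConv_injective
    rw [← show _ = (ισ' * ισ).ofConv from h]
    ext x y
    simp [LinearMap.convOne_def]
  let Γ : WithConv (H ⊗[k] H →ₗ[k] S.CrossedProduct) := toConv (S.γ ∘ₗ LinearMap.mul' k H)
  let Γ₂ : WithConv (H ⊗[k] H →ₗ[k] S.CrossedProduct) :=
    toConv (LinearMap.mul' k S.CrossedProduct ∘ₗ TensorProduct.map S.γ S.γ)
  have hΓ : ισ * Γ = Γ₂ := by
    ext h l
    change (ισ * Γ) (h ⊗ₜ l) = S.γ h * S.γ l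
    rw [((ℛ k h).tmul (ℛ k l)).convMul_apply, Repr.tmul_index, Finset.sum_product,
      S.γ_mul_γ_repr h l (ℛ k h) (ℛ k l)]
    simp only [elt_eq]
    rfl
  let K : WithConv (H ⊗[k] H →ₗ[k] S.CrossedProduct) := ισ' * extendCounit H (toConv S.γ)
  let γ₂ : WithConv (H ⊗[k] H →ₗ[k] S.CrossedProduct) :=
    toConv (S.γ ∘ₗ (TensorProduct.lid k H).toLinearMap ∘ₗ counit.rTensor H)
  have γ₂_tmul : ∀ h l, γ₂ (h ⊗ₜ l) = counit (R := k) h • S.γ l := by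
    intro h l
    change S.γ (counit (R := k) h • l) = _
    rw [map_smul]
  have hΓ₂ : Γ₂ = extendCounit H (toConv S.γ) * γ₂ := by
    ext h l
    change S.γ h * S.γ l = (extendCounit H (toConv S.γ) * γ₂) (h ⊗ₜ l)
    rw [extendCounit_mul_tmul]
    conv_lhs => rw [← sum_counit_smul_left (ℛ k h)]
    simp only [γ₂_tmul, map_sum, map_smul, Finset.sum_mul, smul_mul_assoc, mul_smul_comm]
  have hK : Γ = K * γ₂ := by
    rw [mul_assoc, ← hΓ₂, ← hΓ, ← mul_assoc, hσ, one_mul]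
  have hKγ : ∀ h l, S.γ (h * l) =
      ∑ j ∈ (ℛ k l).index, K (h ⊗ₜ (ℛ k l).left j) * S.γ ((ℛ k l).right j) := by
    intro h l
    have : Γ (h ⊗ₜ l) = (K * γ₂) (h ⊗ₜ l) := by rw [hK]
    rw [((ℛ k h).tmul (ℛ k l)).convMul_apply, Repr.tmul_index, Finset.sum_product_right] at this
    refine Eq.trans this (Finset.sum_congr rfl fun j _ => ?_)
    have h1 : ∀ m, K (h ⊗ₜ m) =
        ∑ i ∈ (ℛ k h).index, counit (R := k) ((ℛ k h).right i) • K ((ℛ k h).left i ⊗ₜ m) := by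
      intro m
      conv_lhs => rw [← sum_counit_smul_left (ℛ k h)]
      simp only [TensorProduct.sum_tmul, map_sum, ← TensorProduct.smul_tmul', map_smul]
    rw [h1, Finset.sum_mul]
    simp only [Repr.tmul_left, Repr.tmul_right, γ₂_tmul, mul_smul_comm, smul_mul_assoc]
  let s := HopfAlgebra.antipode k (A := H)
  refine ⟨toConv (K.ofConv ∘ₗ s.rTensor H ∘ₗ comul), ?_⟩
  ext h
  let L : H ⊗[k] (H ⊗[k] H) →ₗ[k] S.CrossedProduct :=
    LinearMap.mul' k S.CrossedProduct ∘ₗ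
      TensorProduct.map (K.ofConv ∘ₗ s.rTensor H) S.γ ∘ₗ
        (TensorProduct.assoc k H H H).symm.toLinearMap
  have e1 : (toConv (K.ofConv ∘ₗ s.rTensor H ∘ₗ comul) * toConv S.γ) h =
      L (TensorProduct.assoc k H H H (comul.rTensor H (comul h))) := by
    rw [(ℛ k h).convMul_apply]
    conv_rhs => rw [← (ℛ k h).eq]
    simp only [map_sum, LinearMap.rTensor_tmul, L, LinearMap.comp_apply, LinearEquiv.coe_coe,
      LinearEquiv.symm_apply_apply, TensorProduct.map_tmul, LinearMap.mul'_apply]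
  have e2 : L (comul.lTensor H (comul h)) = S.γ (LinearMap.mul' k H (s.rTensor H (comul h))) := by
    conv_lhs => rw [← (ℛ k h).eq]
    conv_rhs => rw [← (ℛ k h).eq]
    simp only [map_sum, LinearMap.lTensor_tmul, LinearMap.rTensor_tmul, LinearMap.mul'_apply, hKγ]
    refine Finset.sum_congr rfl fun i _ => ?_
    conv_lhs => rw [← (ℛ k ((ℛ k h).right i)).eq]
    simp only [TensorProduct.tmul_sum, map_sum]
    rfl
  change (toConv (K.ofConv ∘ₗ s.rTensor H ∘ₗ comul) * toConv S.γ) h = _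
  rw [e1, coassoc_apply, e2, HopfAlgebra.mul_antipode_rTensor_comul_apply]
  simp [Algebra.algebraMap_eq_smul_one, γ_one]

/-! ### Characters act by automorphisms -/

/-- The right translation `h ↦ ∑ h₁ χ(h₂)` by a character `χ`. -/
def translation (χ : WithConv (H →ₐ[k] k)) : H →ₐ[k] H :=
  (Algebra.TensorProduct.rid k k H).toAlgHom.comp
    ((Algebra.TensorProduct.map (AlgHom.id k H) χ.ofConv).comp (Bialgebra.comulAlgHom k H))

theorem translation_repr (χ : WithConv (H →ₐ[k] k)) {κ : Type*} {h : H}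
    (r : Coalgebra.Repr k h κ) :
    translation χ h = ∑ i ∈ r.index, χ (r.right i) • r.left i := by
  change Algebra.TensorProduct.rid k k H
    (Algebra.TensorProduct.map (AlgHom.id k H) χ.ofConv (comul h)) = _
  rw [← r.eq]
  simp

theorem comul_translation (χ : WithConv (H →ₐ[k] k)) (h : H) :
    comul (R := k) (translation χ h) = (translation χ).toLinearMap.lTensor H (comul h) := by
  let L : H ⊗[k] (H ⊗[k] H) →ₗ[k] H ⊗[k] H :=
    ((TensorProduct.rid k H).toLinearMap ∘ₗ χ.ofConv.toLinearMap.lTensor H).lTensor H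
  have e1 : comul (R := k) (translation χ h) =
      L (TensorProduct.assoc k H H H (comul.rTensor H (comul h))) := by
    rw [translation_repr χ (ℛ k h)]
    conv_rhs => rw [← (ℛ k h).eq]
    simp only [map_sum, map_smul, LinearMap.rTensor_tmul]
    refine Finset.sum_congr rfl fun i _ => ?_
    rw [← (ℛ k ((ℛ k h).left i)).eq]
    simp [L, TensorProduct.sum_tmul, Finset.smul_sum]
  rw [e1, coassoc_apply]
  conv_lhs => rw [← (ℛ k h).eq]
  conv_rhs => rw [← (ℛ k h).eq]
  simp only [map_sum, LinearMap.lTensor_tmul, L]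
  rfl

/-- The expression of `Δ` of a translate by the translates of the right factors. -/
@[simps]
def translationRepr (χ : WithConv (H →ₐ[k] k)) (h : H) :
    Coalgebra.Repr k (translation χ h) (H × H) where
  index := (ℛ k h).index
  left := (ℛ k h).left
  right i := translation χ ((ℛ k h).right i)
  eq := by
    rw [comul_translation]
    conv_rhs => rw [← (ℛ k h).eq]
    simp

theorem counit_translation (χ : WithConv (H →ₐ[k] k)) (h : H) :
    counit (R := k) (translation χ h) = χ h := by
  rw [translation_repr χ (ℛ k h)]
  conv_rhs => rw [← sum_counit_smul (ℛ k h)]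
  change _ = χ.ofConv _
  simp [mul_comm]

theorem mulMap_lTensor_translation (χ : WithConv (H →ₐ[k] k)) (a b : R) (h l : H) :
    (translation χ).toLinearMap.lTensor R (S.mulMap (a ⊗ₜ h) (b ⊗ₜ l)) =
      S.mulMap (a ⊗ₜ translation χ h) (b ⊗ₜ translation χ l) := by
  have h1 : ∀ x : R ⊗[k] H, (translation χ).toLinearMap.lTensor R ((a ⊗ₜ 1) * x) =
      (a ⊗ₜ 1) * (translation χ).toLinearMap.lTensor R x := by
    intro x
    induction x with
    | zero => simp
    | add x y hx hy => rw [mul_add, map_add, map_add, hx, hy, mul_add]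
    | tmul c m => simp
  have h2 : S.mulAux b = inl (extendCounit H (S.actOn b) * S.σ.val) * inr (LinearMap.mul' k H) := by
    rw [mulAux, twist, inl_mul, inl_extendCounit, mul_assoc]
  rw [mulMap_tmul, mulMap_tmul, h1, h2, ((ℛ k h).tmul (ℛ k l)).convMul_apply,
    ((translationRepr χ h).tmul (translationRepr χ l)).convMul_apply, map_sum]
  simp [Repr.tmul_index]

/-- The automorphism `a # h ↦ ∑ a # h₁ χ(h₂)` of the crossed product given by a character. -/
def charAut (χ : WithConv (H →ₐ[k] k)) : S.CrossedProduct →ₐ[k] S.CrossedProduct :=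
  let f : S.CrossedProduct →ₗ[k] S.CrossedProduct := (translation χ).toLinearMap.lTensor R
  AlgHom.ofLinearMap f
    (by
      change S.elt 1 (translation χ 1) = S.elt 1 1
      rw [map_one])
    (fun x y => by
      induction x using CrossedProduct.induction with
      | zero => rw [zero_mul, map_zero, zero_mul]
      | add x x' hx hx' => rw [add_mul, map_add, map_add, hx, hx', add_mul]
      | elt a h =>
        induction y using CrossedProduct.induction with
        | zero => rw [mul_zero, map_zero, mul_zero]
        | add y y' hy hy' => rw [mul_add, map_add, map_add, hy, hy', mul_add]
        | elt b l => exact S.mulMap_lTensor_translation χ a b h l)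

theorem charAut_elt (χ : WithConv (H →ₐ[k] k)) (a : R) (h : H) :
    S.charAut χ (S.elt a h) = S.elt a (translation χ h) := rfl

theorem charAut_ι (χ : WithConv (H →ₐ[k] k)) (a : R) : S.charAut χ (S.ι a) = S.ι a := by
  rw [ι_apply, charAut_elt, map_one]

theorem slice_counit_charAut (χ : WithConv (H →ₐ[k] k)) (x : S.CrossedProduct) :
    S.slice counit (S.charAut χ x) = S.slice χ.ofConv.toLinearMap x := by
  induction x using CrossedProduct.induction with
  | zero => simp
  | add x y hx hy => rw [map_add, map_add, map_add, hx, hy]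
  | elt a h =>
    rw [charAut_elt, slice_elt, slice_elt, counit_translation]
    rfl

end General

/-! ### Commutative Hopf algebras -/

section Commutative

variable {k : Type u} {H : Type v} {R : Type w} [Field k] [CommRing H] [HopfAlgebra k H]
  [Ring R] [Algebra k R] (S : TwistedModuleAlgebra k H R)

theorem translation_one (h : H) : translation (1 : WithConv (H →ₐ[k] k)) h = h := by
  rw [translation_repr 1 (ℛ k h)]
  conv_rhs => rw [← sum_counit_smul_left (ℛ k h)]
  simp

theorem translation_mul (χ η : WithConv (H →ₐ[k] k)) (h : H) :
    translation (χ * η) h = translation χ (translation η h) := by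
  let L : H ⊗[k] (H ⊗[k] H) →ₗ[k] H :=
    (TensorProduct.rid k H).toLinearMap ∘ₗ
      (LinearMap.mul' k k ∘ₗ TensorProduct.map χ.ofConv.toLinearMap
        η.ofConv.toLinearMap).lTensor H
  have e1 : translation (χ * η) h = L (comul.lTensor H (comul h)) := by
    rw [translation_repr _ (ℛ k h)]
    conv_rhs => rw [← (ℛ k h).eq]
    simp only [map_sum, LinearMap.lTensor_tmul, L, LinearMap.comp_apply, LinearEquiv.coe_coe,
      TensorProduct.rid_tmul]
    refine Finset.sum_congr rfl fun i _ => ?_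
    rw [AlgHom.convMul_apply]
    conv_lhs => rw [← (ℛ k ((ℛ k h).right i)).eq]
    conv_rhs => rw [← (ℛ k ((ℛ k h).right i)).eq]
    simp
  have e2 : L (TensorProduct.assoc k H H H (comul.rTensor H (comul h))) =
      translation χ (translation η h) := by
    rw [translation_repr η (ℛ k h)]
    conv_lhs => rw [← (ℛ k h).eq]
    simp only [map_sum, map_smul, LinearMap.rTensor_tmul]
    refine Finset.sum_congr rfl fun i _ => ?_
    rw [translation_repr χ (ℛ k ((ℛ k h).left i))]
    conv_lhs => rw [← (ℛ k ((ℛ k h).left i)).eq]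
    simp [L, TensorProduct.sum_tmul, Finset.smul_sum, smul_smul, mul_comm]
  rw [e1, ← coassoc_apply, e2]

theorem charAut_one (x : S.CrossedProduct) : S.charAut 1 x = x := by
  induction x using CrossedProduct.induction with
  | zero => simp
  | add x y hx hy => rw [map_add, hx, hy]
  | elt a h => rw [charAut_elt, translation_one]

theorem charAut_mul (χ η : WithConv (H →ₐ[k] k)) (x : S.CrossedProduct) :
    S.charAut (χ * η) x = S.charAut χ (S.charAut η x) := by
  induction x using CrossedProduct.induction with
  | zero => simp
  | add x y hx hy => rw [map_add, map_add, map_add, hx, hy]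
  | elt a h => rw [charAut_elt, charAut_elt, charAut_elt, translation_mul]

theorem charAut_mem_jacobson (χ : WithConv (H →ₐ[k] k)) {x : S.CrossedProduct}
    (hx : x ∈ Ring.jacobson S.CrossedProduct) :
    S.charAut χ x ∈ Ring.jacobson S.CrossedProduct := by
  have : RingHomSurjective (S.charAut χ).toRingHom := ⟨fun y => ⟨S.charAut χ⁻¹ y, by
    change S.charAut χ (S.charAut χ⁻¹ y) = y
    rw [← charAut_mul, mul_inv_cancel, charAut_one]⟩⟩
  exact Ring.le_comap_jacobson (S.charAut χ).toRingHom hx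

theorem eq_zero_of_slice [IsAlgClosed k] [IsSemisimpleRing H] {x : S.CrossedProduct}
    (hx : ∀ χ : WithConv (H →ₐ[k] k), S.slice χ.ofConv.toLinearMap x = 0) : x = 0 := by
  let B := Module.Basis.ofVectorSpace k R
  obtain ⟨c, hc⟩ := TensorProduct.eq_repr_basis_left B (show R ⊗[k] H from x)
  have hx' : x = c.sum fun i h => S.elt (B i) h := hc.symm
  have hc0 : ∀ i, c i = 0 := by
    intro i
    refine eq_zero_of_characters (k := k) fun χ => ?_
    have h := hx χ
    rw [hx', Finsupp.sum, map_sum] at h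
    simp only [slice_elt] at h
    by_cases hi : i ∈ c.support
    · exact linearIndependent_iff'.1 B.linearIndependent c.support _ h i hi
    · rw [Finsupp.notMem_support_iff.1 hi]
      exact map_zero χ.ofConv
  rw [hx', Finsupp.sum]
  exact Finset.sum_eq_zero fun i _ => by rw [hc0]; exact TensorProduct.tmul_zero H (B i)

/-- The fixed ring of the action of the characters is `R`. -/
theorem mem_range_ι_of_fixed [IsAlgClosed k] [IsSemisimpleRing H] {x : S.CrossedProduct}
    (hx : ∀ χ : WithConv (H →ₐ[k] k), S.charAut χ x = x) : x ∈ Set.range S.ι := by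
  refine ⟨S.slice counit x, ?_⟩
  rw [eq_comm, ← sub_eq_zero]
  refine S.eq_zero_of_slice fun χ => ?_
  rw [map_sub, ← slice_counit_charAut, ← slice_counit_charAut, hx, charAut_ι, slice_counit_ι,
    sub_self]

/-- The crossed product is a Galois extension of `R` for the action of the characters. -/
theorem exists_galois_coordinates [IsSemisimpleRing H] [DecidableEq (WithConv (H →ₐ[k] k))] :
    ∃ (n : Finset (H × H)) (x y : H × H → S.CrossedProduct), ∀ χ : WithConv (H →ₐ[k] k),
      ∑ i ∈ n, S.charAut χ (x i) * y i = if χ = 1 then 1 else 0 := by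
  obtain ⟨p, hp⟩ := exists_dual_trivial_character (k := k) (H := H)
  obtain ⟨β, hβ⟩ := S.exists_leftInverse_γ
  have key : ∀ χ : WithConv (H →ₐ[k] k),
      ∑ i ∈ (ℛ k p).index, β ((ℛ k p).left i) * S.charAut χ (S.γ ((ℛ k p).right i)) =
        if χ = 1 then 1 else 0 := by
    intro χ
    let χ' : WithConv (H →ₗ[k] S.CrossedProduct) :=
      toConv (Algebra.linearMap k S.CrossedProduct ∘ₗ χ.ofConv.toLinearMap)
    have hχ' : ∀ h, χ' h = algebraMap k S.CrossedProduct (χ h) := fun h => rfl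
    have h1 : toConv ((S.charAut χ).toLinearMap ∘ₗ S.γ) = toConv S.γ * χ' := by
      ext h
      change S.elt 1 (translation χ h) = (toConv S.γ * χ') h
      rw [← γ_apply, translation_repr χ (ℛ k h), (ℛ k h).convMul_apply, map_sum]
      refine Finset.sum_congr rfl fun i _ => ?_
      rw [map_smul, hχ', ← Algebra.commutes, ← Algebra.smul_def]
    have h2 : (β * toConv ((S.charAut χ).toLinearMap ∘ₗ S.γ)) p = χ' p := by
      rw [h1, ← mul_assoc, hβ, one_mul]
    rw [(ℛ k p).convMul_apply, hχ', hp] at h2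
    refine Eq.trans h2 ?_
    split_ifs <;> simp
  refine ⟨(ℛ k p).index, fun i => β ((ℛ k p).left i), fun i => S.γ ((ℛ k p).right i), fun χ => ?_⟩
  have := congrArg (S.charAut χ) (key χ⁻¹)
  rw [map_sum] at this
  simp only [map_mul, ← charAut_mul, mul_inv_cancel, charAut_one, inv_eq_one] at this
  rw [this]
  split_ifs <;> simp

theorem radicals_eq_of_comm [IsAlgClosed k] [IsSemisimpleRing H] (hco : IsCosemisimple k H) :
    Ring.jacobson R = S.hJacobson ∧ S.hJacobson = S.jacobsonH ∧
      (Ring.jacobson S.CrossedProduct : Set S.CrossedProduct) = S.idealCrossed S.hJacobson := by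
  classical
  have := finite_characters (k := k) (H := H)
  let := Fintype.ofFinite (WithConv (H →ₐ[k] k))
  have hG : IsUnit (Fintype.card (WithConv (H →ₐ[k] k)) : R) := by
    have := (card_characters_ne_zero hco).isUnit.map (algebraMap k R)
    rwa [map_natCast] at this
  refine S.radicals_eq (fun r hr => ?_) fun z hz => ?_
  · exact map_mem_jacobson_of_fixedRing (fun χ => (S.charAut χ).toRingHom) S.charAut_one
      S.charAut_mul S.ι.toRingHom S.charAut_ι (fun x hx => S.mem_range_ι_of_fixed hx) hG hr
  · obtain ⟨n, x, y, hxy⟩ := S.exists_galois_coordinates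
    -- `z` is recovered from the traces of the products `z * x i`
    have hz' : z = ∑ i ∈ n, (∑ χ, S.charAut χ (z * x i)) * y i := by
      simp only [Finset.sum_mul, map_mul, mul_assoc]
      rw [Finset.sum_comm]
      simp only [← Finset.mul_sum, hxy]
      simp [charAut_one]
    rw [hz']
    refine Submodule.sum_mem _ fun i _ => ?_
    obtain ⟨r, hr⟩ := S.mem_range_ι_of_fixed (x := ∑ χ, S.charAut χ (z * x i)) fun η => by
      rw [map_sum, ← Equiv.sum_comp (Equiv.mulLeft η) fun χ => S.charAut χ (z * x i)]
      exact Finset.sum_congr rfl fun χ _ => (S.charAut_mul η χ _).symm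
    rw [← hr]
    refine S.ι_mul_mem_idealCrossed (S.mem_jacobson_of_ι_mem ?_) _
    rw [hr]
    exact Submodule.sum_mem _ fun χ _ =>
      S.charAut_mem_jacobson χ (Ideal.mul_mem_right _ _ hz)

end Commutative

/-! ### Cocommutative Hopf algebras -/

section GroupLike

variable {k : Type u} {H : Type v} {R : Type w} [Field k] [Ring H] [HopfAlgebra k H]
  [Ring R] [Algebra k R] (S : TwistedModuleAlgebra k H R)

/-- The expression `Δ g = g ⊗ g` for a group-like element. -/
@[simps]
def groupLikeRepr (g : GroupLike k H) : Coalgebra.Repr k g.val Unit where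
  index := {()}
  left _ := g.val
  right _ := g.val
  eq := by simp [g.isGroupLikeElem_val.comul_eq_tmul_self]

theorem act_mul_groupLike (g : GroupLike k H) (r s : R) :
    S.act g.val (r * s) = S.act g.val r * S.act g.val s := by
  let f : H ⊗[k] H →ₗ[k] R :=
    LinearMap.mul' k R ∘ₗ TensorProduct.map (S.act.flip r) (S.act.flip s)
  have h : ∑ i ∈ (ℛ k g.val).index, S.act ((ℛ k g.val).left i) r * S.act ((ℛ k g.val).right i) s =
      f (comul g.val) := by
    rw [← (ℛ k g.val).eq, map_sum]
    rfl
  rw [act_mul, h, g.isGroupLikeElem_val.comul_eq_tmul_self]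
  rfl

theorem convMul_groupLike (f f' : WithConv (H ⊗[k] H →ₗ[k] R)) (g h : GroupLike k H) :
    (f * f') (g.val ⊗ₜ h.val) = f (g.val ⊗ₜ h.val) * f' (g.val ⊗ₜ h.val) := by
  rw [((groupLikeRepr g).tmul (groupLikeRepr h)).convMul_apply]
  simp [Repr.tmul_index]

theorem counit_tmul_groupLike (g h : GroupLike k H) :
    (1 : WithConv (H ⊗[k] H →ₗ[k] R)) (g.val ⊗ₜ h.val) = 1 := by
  simp [g.isGroupLikeElem_val.counit_eq_one, h.isGroupLikeElem_val.counit_eq_one]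

variable [Fintype (GroupLike k H)] [DecidableEq (GroupLike k H)]

/-- If the group-like elements form a basis of `H`, then `H` is a group algebra and `R #_σ H` is a
crossed product of `R` by a group. -/
def groupCrossedProduct (b : Module.Basis (GroupLike k H) k H) (hb : ∀ g, b g = g.val) :
    GroupCrossedProduct R S.CrossedProduct (GroupLike k H) where
  ι := S.ι.toRingHom
  γ g := S.γ g.val
  φ g :=
    { toFun := S.act g.val
      map_one' := by rw [act_one, g.isGroupLikeElem_val.counit_eq_one, one_smul]
      map_mul' := S.act_mul_groupLike g
      map_zero' := map_zero _
      map_add' := map_add _ }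
  c g h :=
    { val := S.σ.val (g.val ⊗ₜ h.val)
      inv := S.σ⁻¹.val (g.val ⊗ₜ h.val)
      val_inv := by rw [← convMul_groupLike, Units.mul_inv, counit_tmul_groupLike]
      inv_val := by rw [← convMul_groupLike, Units.inv_mul, counit_tmul_groupLike] }
  coeff :=
    { toFun := fun x g => S.slice (b.coord g) x
      map_zero' := by ext; simp
      map_add' := fun x y => by ext; simp }
  γ_one := S.γ_one
  γ_mul g h := by
    rw [S.γ_mul_γ_repr g.val h.val (groupLikeRepr g) (groupLikeRepr h)]
    simp [elt_eq]
  γ_ι g r := by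
    change S.γ g.val * S.ι r = S.ι (S.act g.val r) * S.γ g.val
    rw [S.γ_mul_ι_repr g.val r (groupLikeRepr g)]
    simp [elt_eq]
  coeff_ι_mul r x g := S.slice_ι_mul _ r x
  coeff_γ g := by
    ext h
    change S.slice (b.coord h) (S.elt 1 g.val) = _
    rw [slice_elt, ← hb, Module.Basis.coord_apply, Module.Basis.repr_self]
    rw [Finsupp.single_apply, Pi.single_apply, ite_smul, one_smul, zero_smul]
    simp only [eq_comm]
  sum_coeff x := by
    change ∑ g, S.ι (S.slice (b.coord g) x) * S.γ g.val = x
    induction x using CrossedProduct.induction with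
    | zero => simp
    | add x y hx hy =>
      simp only [map_add, add_mul, Finset.sum_add_distrib]
      rw [hx, hy]
    | elt a h =>
      rw [elt_eq]
      conv_rhs => rw [← b.sum_repr h, map_sum, Finset.mul_sum]
      refine Finset.sum_congr rfl fun g _ => ?_
      rw [slice_ι_mul, γ_apply, slice_elt, hb, map_smul, mul_smul_comm, Module.Basis.coord_apply,
        mul_smul_comm, mul_one, map_smul, smul_mul_assoc]

end GroupLike

theorem radicals_eq_of_isCocomm {k : Type u} {H : Type v} {R : Type w} [Field k] [IsAlgClosed k]
    [Ring H] [HopfAlgebra k H] [IsSemisimpleRing H] [IsCocomm k H] (hco : IsCosemisimple k H)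
    [Ring R] [Algebra k R] (S : TwistedModuleAlgebra k H R) :
    Ring.jacobson R = S.hJacobson ∧ S.hJacobson = S.jacobsonH ∧
      (Ring.jacobson S.CrossedProduct : Set S.CrossedProduct) = S.idealCrossed S.hJacobson := by
  classical
  have := finite_of_isSemisimpleRing (k := k) (H := H)
  have := finite_groupLike (k := k) (C := H)
  let := Fintype.ofFinite (GroupLike k H)
  let b : Module.Basis (GroupLike k H) k H :=
    Module.Basis.mk linearIndep_groupLikeVal (span_groupLike_eq_top hco).ge
  have hb : ∀ g, b g = g.val := fun g => Module.Basis.mk_apply _ _ g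
  let X := S.groupCrossedProduct b hb
  have hG : IsUnit (Fintype.card (GroupLike k H) : R) := by
    have := (card_groupLike_ne_zero b hb).isUnit.map (algebraMap k R)
    rwa [map_natCast] at this
  refine S.radicals_eq (fun r hr => X.ι_mem_jacobson hr) fun x hx => ?_
  rw [← X.sum_coeff x]
  exact Submodule.sum_mem _ fun g _ =>
    S.ι_mul_mem_idealCrossed (X.coeff_mem_jacobson hG hx g) _

end TwistedModuleAlgebra

end

theorem corollary2p8 {k : Type*} {H : Type*} {R : Type*} [Field k] [IsAlgClosed k]
    [Ring H] [HopfAlgebra k H] [IsSemisimpleRing H] (hcosemi : IsCosemisimple k H)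
    (hcomm : (∀ x y : H, x * y = y * x) ∨ Coalgebra.IsCocomm k H)
    [Ring R] [Algebra k R] (S : TwistedModuleAlgebra k H R) :
    Ring.jacobson R = S.hJacobson ∧ S.hJacobson = S.jacobsonH ∧
      (Ring.jacobson S.CrossedProduct : Set S.CrossedProduct) = S.idealCrossed S.hJacobson := by
  rcases hcomm with hcomm | hcomm
  · let : CommRing H := { ‹Ring H› with mul_comm := hcomm }
    exact S.radicals_eq_of_comm hcosemi
  · exact TwistedModuleAlgebra.radicals_eq_of_isCocomm hcosemi S
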